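/- All digraphs are finite and strict (no loops, no multiple arcs). The wheel $W_3$ is the digraph on four vertices that consists of a directed cycle of length $3$ (the rim) and one further vertex, the centre, which dominates each of the three rim vertices. A subdivision of a digraph $F$ is a digraph obtained from $F$ by replacing each arc $ab$ of $F$ by a directed $(a,b)$-path, where the interiors of these paths are pairwise disjoint and contain no vertex of $F$. The problem $W_3$-Subdivision is: given a digraph $D$, does $D$ contain a subdivision of $W_3$ as a subdigraph? **Theorem.** $W_3$-Subdivision can be solved in $O(n^6(n+m))$ time, where $n\ge 1$ and $m$ are the numbers of vertices and arcs of the input digraph $D$. That is, there are a program of a random access machine (unit-cost instructions; indirect addressing; successor, predecessor and comparison as the only arithmetic operations) and a constant $K$ such that, for every digraph $D$ on the vertices $0,\dots,n-1$, given by its lists of outneighbours in any order, the program halts after at most $K\,n^6(n+m)$ steps and answers correctly whether $D$ contains a subdivision of $W_3$. -/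

import Mathlib

/-! ## Digraphs and subdivisions -/

/-- A strict digraph has no loops (multiple arcs are impossible for `Digraph`). -/
def Digraph.IsStrict {V : Type*} (D : Digraph V) : Prop :=
  ∀ v, ¬ D.Adj v v

/-- The number `m` of arcs of a digraph (on a finite vertex set). -/
noncomputable def Digraph.numArcs {V : Type*} (D : Digraph V) : ℕ :=
  {a : V × V | D.Adj a.1 a.2}.ncard

/-- `D` contains a subdivision of `F` as a subdigraph.

`f` gives the original vertices (the vertices of `D` that correspond to vertices of `F`), and
`p u v` lists, in order, the internal vertices of the dipath from `f u` to `f v` that replaces the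
arc `uv` of `F`. The internal vertices of such a dipath are distinct, none of them is an original
vertex, and dipaths that replace distinct arcs share no internal vertex. -/
def Digraph.ContainsSubdivision {V W : Type*} (D : Digraph V) (F : Digraph W) : Prop :=
  ∃ (f : W → V) (p : W → W → List V),
    Function.Injective f ∧
    (∀ u v, F.Adj u v →
      List.IsChain D.Adj (f u :: (p u v ++ [f v])) ∧
      (p u v).Nodup ∧
      ∀ x ∈ p u v, x ∉ Set.range f) ∧
    (∀ u v u' v', F.Adj u v → F.Adj u' v' → (u, v) ≠ (u', v') →
      List.Disjoint (p u v) (p u' v'))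

/-- The wheel `W₃`: a directed 3-cycle `some 0 → some 1 → some 2 → some 0` (the rim) together with
a vertex `none` (the centre) that dominates the three rim vertices. -/
def wheel3 : Digraph (Option (Fin 3)) where
  Adj
    | none, some _ => True
    | some i, some j => j = i + 1
    | _, none => False

/-! ## A random access machine with unit-cost instructions

The machine has scalar registers and arrays, all of which hold natural numbers; a program is a
fixed finite text, so it names only finitely many registers and arrays. Arrays are accessed by
computed indices (indirect addressing). The only arithmetic operations are successor and
predecessor, so a computation of `t` steps never creates a number that exceeds the numbers in its
input and its text by more than `t`: no arithmetic on long numbers is hidden in a unit-cost step.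
Control is structured (sequence, branch, loop). -/

namespace RAM

/-- The memory: scalar registers `reg i` and arrays `arr a`. -/
structure Memory where
  reg : ℕ → ℕ
  arr : ℕ → ℕ → ℕ

/-- Expressions. -/
inductive Expr where
  /-- the numeral `k` -/
  | const (k : ℕ)
  /-- the content of register `i` -/
  | reg (i : ℕ)
  /-- the entry of array `a` at the computed index `e` -/
  | get (a : ℕ) (e : Expr)
  | succ (e : Expr)
  /-- predecessor, with `pred 0 = 0` -/
  | pred (e : Expr)
  /-- comparison `<`, with value `1` or `0` -/
  | lt (e₁ e₂ : Expr)
  /-- comparison `=`, with value `1` or `0` -/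
  | eq (e₁ e₂ : Expr)

/-- The value of an expression. -/
def Expr.eval (s : Memory) : Expr → ℕ
  | const k => k
  | reg i => s.reg i
  | get a e => s.arr a (e.eval s)
  | succ e => e.eval s + 1
  | pred e => e.eval s - 1
  | lt e₁ e₂ => if e₁.eval s < e₂.eval s then 1 else 0
  | eq e₁ e₂ => if e₁.eval s = e₂.eval s then 1 else 0

/-- The number of steps for evaluating an expression: one for each operation in it. -/
def Expr.cost : Expr → ℕ
  | const _ => 1
  | reg _ => 1
  | get _ e => e.cost + 1
  | succ e => e.cost + 1
  | pred e => e.cost + 1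
  | lt e₁ e₂ => e₁.cost + e₂.cost + 1
  | eq e₁ e₂ => e₁.cost + e₂.cost + 1

/-- Programs. -/
inductive Program where
  | skip
  /-- `reg i := e` -/
  | assign (i : ℕ) (e : Expr)
  /-- `arr a [e₁] := e₂` -/
  | store (a : ℕ) (e₁ e₂ : Expr)
  | seq (P Q : Program)
  /-- `if e ≠ 0 then P else Q` -/
  | ite (e : Expr) (P Q : Program)
  /-- `while e ≠ 0 do P` -/
  | while (e : Expr) (P : Program)

/-- The memory after `reg i := x`. -/
def Memory.setReg (s : Memory) (i x : ℕ) : Memory :=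
  { s with reg := Function.update s.reg i x }

/-- The memory after `arr a [j] := x`. -/
def Memory.setArr (s : Memory) (a j x : ℕ) : Memory :=
  { s with arr := Function.update s.arr a (Function.update (s.arr a) j x) }

/-- `Exec P s t s'`: started with memory `s`, the program `P` halts after exactly `t` steps with
memory `s'`. Each instruction costs one step plus the cost of the expressions that it evaluates;
a loop pays for its test each time the test is evaluated. -/
inductive Exec : Program → Memory → ℕ → Memory → Prop where
  | skip (s : Memory) : Exec .skip s 1 s
  | assign (i : ℕ) (e : Expr) (s : Memory) :
      Exec (.assign i e) s (e.cost + 1) (s.setReg i (e.eval s))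
  | store (a : ℕ) (e₁ e₂ : Expr) (s : Memory) :
      Exec (.store a e₁ e₂) s (e₁.cost + e₂.cost + 1) (s.setArr a (e₁.eval s) (e₂.eval s))
  | seq {P Q : Program} {s s' s'' : Memory} {t t' : ℕ} :
      Exec P s t s' → Exec Q s' t' s'' → Exec (.seq P Q) s (t + t') s''
  | ite_true {e : Expr} {P Q : Program} {s s' : Memory} {t : ℕ} :
      e.eval s ≠ 0 → Exec P s t s' → Exec (.ite e P Q) s (e.cost + 1 + t) s'
  | ite_false {e : Expr} {P Q : Program} {s s' : Memory} {t : ℕ} :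
      e.eval s = 0 → Exec Q s t s' → Exec (.ite e P Q) s (e.cost + 1 + t) s'
  | while_true {e : Expr} {P : Program} {s s' s'' : Memory} {t t' : ℕ} :
      e.eval s ≠ 0 → Exec P s t s' → Exec (.while e P) s' t' s'' →
      Exec (.while e P) s (e.cost + 1 + t + t') s''
  | while_false {e : Expr} {P : Program} {s : Memory} :
      e.eval s = 0 → Exec (.while e P) s (e.cost + 1) s

/-- The memory `s` holds exactly the digraph `D` on the vertices `0, …, n - 1`, given by the
lists of outneighbours, each in an arbitrary order: `reg 0` is the number of vertices, `reg 1` is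
the number of arcs, and the outneighbours of `u` are listed, without repetition, in the entries
`arr 1 [i]` with `arr 0 [u] ≤ i < arr 0 [u + 1]`. All other cells of the memory are `0`. -/
structure IsInput {n : ℕ} (D : Digraph (Fin n)) (s : Memory) : Prop where
  reg_zero : s.reg 0 = n
  reg_one : s.reg 1 = D.numArcs
  reg_of_two_le : ∀ i, 2 ≤ i → s.reg i = 0
  offset_zero : s.arr 0 0 = 0
  offset_mono : ∀ u, u < n → s.arr 0 u ≤ s.arr 0 (u + 1)
  offset_last : s.arr 0 n = D.numArcs
  offset_of_lt : ∀ i, n < i → s.arr 0 i = 0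
  outneighbours : ∀ u : Fin n,
    Set.BijOn (s.arr 1) (Set.Ico (s.arr 0 u) (s.arr 0 (u + 1))) {x | ∃ v : Fin n, D.Adj u v ∧ x = v}
  target_of_le : ∀ i, D.numArcs ≤ i → s.arr 1 i = 0
  arr_of_two_le : ∀ a i, 2 ≤ a → s.arr a i = 0

/-- The program `P` decides the property `Q` of strict digraphs, and on every input with `n ≥ 1`
vertices and `m` arcs it halts after at most `T n m` steps. The answer is left in `reg 0`:
`1` for yes and `0` for no. -/
def DecidesInTime (P : Program) (Q : ∀ {n : ℕ}, Digraph (Fin n) → Prop) (T : ℕ → ℕ → ℕ) : Prop :=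
  ∀ (n : ℕ) (D : Digraph (Fin n)) (s : Memory), 1 ≤ n → D.IsStrict → IsInput D s →
    ∃ (t : ℕ) (s' : Memory), Exec P s t s' ∧ t ≤ T n D.numArcs ∧
      ((Q D ∧ s'.reg 0 = 1) ∨ (¬ Q D ∧ s'.reg 0 = 0))

end RAM

/-! A subdivision of `wheel3` with centre `c` is the same as a dicycle `C` avoiding `c` together
with three dipaths from `c` to `C` that meet only in `c`. By Menger's theorem such a fan exists iff
no two vertices other than `c` separate `C` from `c`; in terms of `inBoundary`, every set that
contains `C` but not `c` is entered at three vertices or more (`IsThreeLinked`). What remains is to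
find such a cycle without enumerating cycles, and `IsWheelWitness` does this with four vertices and
reachability queries.

From a cycle to a witness (`exists_isWheelWitness_of_cycle`): among all runs of consecutive cycle
vertices that two vertices cut off from `c`, take a longest one. Its shortest suffix not extendable
backwards while a single vertex cuts it off starts at some `v`; let `u` be the predecessor of `v`
and `w` the successor of the run. Submodularity of the boundary shows that no two vertices cut off
`u`, `v` and `w` together.

From a witness to a cycle (`IsWheelWitness.exists_isDicycle`): the path from `v` to the predecessor
`x` of `w` can be kept among the vertices that `v` cuts off from `c`, and the path from `w` to `u`
stays among those it does not cut off. So the two are disjoint and close up to a dicycle through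
`u`, `v`, `w`, which is three-linked because these three vertices already are.

The algorithm tries all `c`, `v`, `u`, `w`, and for each choice all separating pairs `a`, `b`, with
linear-time searches inside: six nested loops give the factor `n ^ 6`. -/

namespace Digraph

variable {V : Type*}

/-- There is a walk from `s` to `t` that does not enter `a` or `b`. -/
def ReachAvoiding (D : Digraph V) (a b s t : V) : Prop :=
  Relation.ReflTransGen (fun x y => D.Adj x y ∧ y ≠ a ∧ y ≠ b) s t

/-- The vertices of `X` that have an inneighbour outside `X`. -/
noncomputable def inBoundary [Fintype V] (D : Digraph V) (X : Finset V) : Finset V :=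
  open Classical in X.filter fun x => ∃ y, y ∉ X ∧ D.Adj y x

/-- Every set that contains all elements of `l` but not `c` is entered at three vertices or
more. -/
def IsThreeLinked [Fintype V] (D : Digraph V) (c : V) (l : List V) : Prop :=
  ∀ X : Finset V, c ∉ X → (∀ y ∈ l, y ∈ X) → 3 ≤ (D.inBoundary X).card

/-- A certificate, checkable by reachability queries, for a subdivision of `wheel3` with
centre `c`. -/
def IsWheelWitness (D : Digraph V) (c v u w : V) : Prop :=
  c ≠ v ∧ c ≠ u ∧ c ≠ w ∧
  (∀ a b, a ≠ c → b ≠ c →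
    D.ReachAvoiding a b c u ∨ D.ReachAvoiding a b c v ∨ D.ReachAvoiding a b c w) ∧
  D.Adj u v ∧ D.ReachAvoiding c v w u ∧
  ∃ x, D.Adj x w ∧ D.ReachAvoiding c c v x ∧ ¬ D.ReachAvoiding v v c x

theorem _root_.Finset.card_le_two_of_forall_eq_or {S : Finset V} {a b : V} (h : ∀ x ∈ S, x = a ∨ x = b) :
    S.card ≤ 2 := by
  classical
  exact (Finset.card_le_card (t := {a, b}) fun x hx => by simpa using h x hx).trans
    Finset.card_le_two

/-! ### Boundaries of vertex sets and separation by two vertices -/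

section Boundary

variable [Fintype V] {D : Digraph V}

theorem mem_inBoundary {X : Finset V} {x : V} :
    x ∈ D.inBoundary X ↔ x ∈ X ∧ ∃ y, y ∉ X ∧ D.Adj y x := by
  simp [inBoundary]

theorem inBoundary_subset (X : Finset V) : D.inBoundary X ⊆ X :=
  fun _ hx => (mem_inBoundary.1 hx).1

theorem card_inBoundary_singleton_le (x : V) : (D.inBoundary {x}).card ≤ 1 :=
  (Finset.card_le_card (inBoundary_subset _)).trans (by simp)

/-- Submodularity, the tool for uncrossing separations. It is checked vertex by vertex: each vertex
contributes no more to the left side than to the right. -/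
theorem card_inBoundary_union_add_inter_le [DecidableEq V] (X Y : Finset V) :
    (D.inBoundary (X ∪ Y)).card + (D.inBoundary (X ∩ Y)).card ≤
      (D.inBoundary X).card + (D.inBoundary Y).card := by
  rw [← Finset.card_union_add_card_inter, ← Finset.card_union_add_card_inter (D.inBoundary X)]
  refine add_le_add (Finset.card_le_card ?_) (Finset.card_le_card ?_)
  · intro x
    simp only [Finset.mem_union, mem_inBoundary, Finset.mem_inter]
    rintro (⟨h, y, hy, hyx⟩ | ⟨h, y, hy, hyx⟩)
    · rcases h with h | h
      · exact Or.inl ⟨h, y, by tauto, hyx⟩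
      · exact Or.inr ⟨h, y, by tauto, hyx⟩
    · by_cases hX : y ∈ X
      · exact Or.inr ⟨h.2, y, by tauto, hyx⟩
      · exact Or.inl ⟨h.1, y, hX, hyx⟩
  · intro x
    simp only [Finset.mem_union, mem_inBoundary, Finset.mem_inter]
    rintro ⟨⟨_, y, hy, hyx⟩, ⟨h, _⟩⟩
    exact ⟨⟨h.1, y, by tauto, hyx⟩, ⟨h.2, y, by tauto, hyx⟩⟩

theorem not_reachAvoiding_of_inBoundary_subset {X : Finset V} {a b c y : V} (hc : c ∉ X)
    (hX : ∀ x ∈ D.inBoundary X, x = a ∨ x = b) (hy : y ∈ X) : ¬ D.ReachAvoiding a b c y := by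
  intro h
  suffices y ∉ X from this hy
  clear hy
  induction h with
  | refl => exact hc
  | tail _ h ih =>
    intro hz
    rcases hX _ (mem_inBoundary.2 ⟨hz, _, ih, h.1⟩) with h' | h'
    · exact h.2.1 h'
    · exact h.2.2 h'

/-- Take the vertices that `a` and `b` cut off from `c`: one that has a reachable inneighbour and
differs from `a` and `b` would be reachable itself. -/
theorem exists_finset_not_reachAvoiding (D : Digraph V) (a b c : V) :
    ∃ X : Finset V, (∀ y, y ∈ X ↔ ¬ D.ReachAvoiding a b c y) ∧ c ∉ X ∧
      ∀ x ∈ D.inBoundary X, x = a ∨ x = b := by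
  classical
  refine ⟨Finset.univ.filter fun y => ¬ D.ReachAvoiding a b c y, by simp, ?_, ?_⟩
  · rw [Finset.mem_filter]
    exact fun h => h.2 Relation.ReflTransGen.refl
  · intro x hx
    simp only [mem_inBoundary, Finset.mem_filter, Finset.mem_univ, true_and, not_not] at hx
    obtain ⟨hx, y, hy, hyx⟩ := hx
    by_contra! h
    exact hx (hy.tail ⟨hyx, h⟩)

/-- A boundary of at most two vertices, padded if necessary by elements of the set, would be a pair
that blocks every walk from `c` into the set. -/
theorem isThreeLinked_of_reachAvoiding {c : V} {l : List V} (hl : l ≠ [])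
    (h : ∀ a b, a ≠ c → b ≠ c → ∃ y ∈ l, D.ReachAvoiding a b c y) : D.IsThreeLinked c l := by
  classical
  intro X hc hX
  by_contra! hlt
  obtain ⟨z, hz⟩ := List.exists_mem_of_ne_nil l hl
  obtain ⟨a, ha, b, hb, hab⟩ : ∃ a ∈ X, ∃ b ∈ X, ∀ x ∈ D.inBoundary X, x = a ∨ x = b := by
    have hsub := inBoundary_subset (D := D) X
    generalize D.inBoundary X = S at *
    have : S.card = 0 ∨ S.card = 1 ∨ S.card = 2 := by omega
    rcases this with h0 | h1 | h2
    · rw [Finset.card_eq_zero] at h0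
      exact ⟨z, hX z hz, z, hX z hz, by simp [h0]⟩
    · obtain ⟨a, rfl⟩ := Finset.card_eq_one.1 h1
      exact ⟨a, hsub (by simp), a, hsub (by simp), by simp⟩
    · obtain ⟨a, b, _, rfl⟩ := Finset.card_eq_two.1 h2
      exact ⟨a, hsub (by simp), b, hsub (by simp), by simp⟩
  obtain ⟨y, hy, hyr⟩ := h a b (by rintro rfl; exact hc ha) (by rintro rfl; exact hc hb)
  exact not_reachAvoiding_of_inBoundary_subset hc hab (hX y hy) hyr

end Boundary

/-! ### From a three-linked cycle to a witness -/

section CycleToWitness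

variable {D : Digraph V} {z : ℕ → V}

theorem reachAvoiding_along (hz : ∀ i, D.Adj (z i) (z (i + 1))) {a b : V} (i d : ℕ)
    (h : ∀ t, i < t → t ≤ i + d → z t ≠ a ∧ z t ≠ b) :
    D.ReachAvoiding a b (z i) (z (i + d)) := by
  induction d with
  | zero => exact Relation.ReflTransGen.refl
  | succ d ih =>
    exact (ih fun t h1 h2 => h t h1 (by omega)).tail
      ⟨hz (i + d), h (i + (d + 1)) (by omega) le_rfl⟩

/-- In a cycle to which the vertex `c` is linked by a fan of size three, a maximal run that two
vertices separate from `c` is left along a witness. -/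
theorem exists_isWheelWitness_of_cycle [Fintype V] {c : V} {L : ℕ} (hL : 0 < L)
    (hz : ∀ i, D.Adj (z i) (z (i + 1))) (hper : ∀ i, z (i + L) = z i)
    (hinj : ∀ s t, z s = z t → s ≡ t [MOD L]) (hc : ∀ i, z i ≠ c)
    (hlink : ∀ X : Finset V, c ∉ X → (∀ i, z i ∈ X) → 3 ≤ (D.inBoundary X).card) :
    ∃ v u w, D.IsWheelWitness c v u w := by
  classical
  -- The first `k` vertices of the sequence can be cut off from `c` by two vertices.
  let P : (ℕ → V) → ℕ → Prop := fun z k =>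
    ∃ X : Finset V, c ∉ X ∧ (D.inBoundary X).card ≤ 2 ∧ ∀ t < k, z t ∈ X
  have hmul : ∀ i k, z (i + k * L) = z i := by
    intro i k
    induction k with
    | zero => simp
    | succ k ih => rw [add_mul, one_mul, ← add_assoc, hper, ih]
  have hbd : ∃ k, ¬ ∃ i, P (fun t => z (i + t)) k := by
    refine ⟨L, ?_⟩
    rintro ⟨i, X, hcX, hX2, hX⟩
    have := hlink X hcX fun s => by
      -- The offset is congruent to `s - i` modulo `L`, so position `i` plus the offset is the cycle
      -- vertex `z s`.
      have := hX ((s + i * (L - 1)) % L) (Nat.mod_lt _ hL)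
      have h2 := hmul (i + (s + i * (L - 1)) % L) ((s + i * (L - 1)) / L)
      have h3 : i + (s + i * (L - 1)) % L + (s + i * (L - 1)) / L * L = s + i * L := by
        have := Nat.mod_add_div (s + i * (L - 1)) L
        obtain ⟨L, rfl⟩ : ∃ M, L = M + 1 := ⟨L - 1, by omega⟩
        simp only [Nat.add_sub_cancel] at *
        nlinarith
      rw [h3, hmul] at h2
      rw [h2]
      exact this
    omega
  obtain ⟨k, hk⟩ : ∃ k, Nat.find hbd = k + 1 := by
    refine ⟨Nat.find hbd - 1, (Nat.succ_pred_eq_of_pos ?_).symm⟩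
    rw [Nat.find_pos]
    exact not_not.2 ⟨0, ∅, by simp, by simp [inBoundary], by simp⟩
  have hnot : ∀ i, ¬ P (fun t => z (i + t)) (k + 1) := by
    have := Nat.find_spec hbd
    rw [hk] at this
    push Not at this
    exact this
  obtain ⟨i, hi⟩ : ∃ i, P (fun t => z (i + t)) k := by
    have := Nat.find_min hbd (m := k) (by omega)
    exact not_not.1 this
  have hk0 : k ≠ 0 := by
    rintro rfl
    refine hnot 0 ⟨{z 0}, by simpa using (hc 0).symm,
      (card_inBoundary_singleton_le _).trans (by norm_num), ?_⟩
    intro t ht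
    obtain rfl : t = 0 := by omega
    simp
  -- A set with empty boundary is closed under predecessors, so it would contain the whole cycle,
  -- against `hlink`.
  have hpos : ∀ (X : Finset V) t, c ∉ X → z t ∈ X → 1 ≤ (D.inBoundary X).card := by
    intro X t hcX ht
    by_contra! h0
    have h0 : D.inBoundary X = ∅ := by simpa using h0
    have hback : ∀ d s, z (s + d) ∈ X → z s ∈ X := by
      intro d
      induction d with
      | zero => intro s h; exact h
      | succ d ih =>
        intro s h
        apply ih
        by_contra hn
        have : z (s + d + 1) ∈ D.inBoundary X := mem_inBoundary.2 ⟨h, _, hn, hz _⟩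
        simp [h0] at this
    have := hlink X hcX fun s => by
      apply hback (t + s * L - s) s
      have : s + (t + s * L - s) = t + s * L := by
        have := Nat.le_mul_of_pos_right s hL
        omega
      rw [this, hmul]
      exact ht
    simp [h0] at this
  have hkL : k < L := by
    by_contra! h
    obtain ⟨X, h1, h2, h3⟩ := hi
    refine hnot i ⟨X, h1, h2, fun t ht => ?_⟩
    rcases Nat.lt_or_ge t k with h' | h'
    · exact h3 t h'
    · have := h3 (t - L) (by omega)
      change z (i + t) ∈ X
      rw [show z (i + t) = z (i + (t - L) + L) by congr 1; omega, hper]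
      exact this
  -- shift the cycle so that the maximal run starts at `0`
  replace hnot := hnot i
  replace hpos : ∀ (X : Finset V) t, c ∉ X → z (i + t) ∈ X → 1 ≤ (D.inBoundary X).card :=
    fun X t => hpos X (i + t)
  replace hz : ∀ t, D.Adj (z (i + t)) (z (i + (t + 1))) := fun t => hz (i + t)
  replace hper : ∀ t, z (i + (t + L)) = z (i + t) := fun t => by rw [← add_assoc, hper]
  replace hinj : ∀ s t, z (i + s) = z (i + t) → s ≡ t [MOD L] := fun s t h =>
    Nat.ModEq.add_left_cancel' i (hinj _ _ h)
  replace hc : ∀ t, z (i + t) ≠ c := fun t => hc _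
  generalize hy : (fun t => z (i + t)) = y at hi hnot
  have hy' : ∀ t, z (i + t) = y t := fun t => by rw [← hy]
  simp only [hy'] at hpos hz hper hinj hc
  clear hlink hmul hbd hk hy hy'
  obtain ⟨X, hcX, hX2, hX⟩ := hi
  -- Look for the least `j` such that one vertex cuts off the end of the run from position `j` on;
  -- the last vertex alone is always such an end.
  have hQ : ∃ j, ∃ Y : Finset V, c ∉ Y ∧ (D.inBoundary Y).card ≤ 1 ∧
      ∀ t, j ≤ t → t < k → y t ∈ Y :=
    ⟨k - 1, {y (k - 1)}, by simpa using (hc _).symm, card_inBoundary_singleton_le _,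
      fun t h1 h2 => by obtain rfl : t = k - 1 := by omega
                        simp⟩
  obtain ⟨j, hj⟩ : ∃ j, Nat.find hQ = j := ⟨_, rfl⟩
  have hjk : j ≤ k - 1 := by
    rw [← hj]
    exact Nat.find_min' hQ ⟨{y (k - 1)}, by simpa using (hc _).symm,
      card_inBoundary_singleton_le _, fun t h1 h2 => by obtain rfl : t = k - 1 := by omega
                                                        simp⟩
  obtain ⟨Y, hcY, hY1, hY⟩ := hj ▸ Nat.find_spec hQ
  have hmin : ∀ j' < j, ¬ ∃ Y : Finset V, c ∉ Y ∧ (D.inBoundary Y).card ≤ 1 ∧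
      ∀ t, j' ≤ t → t < k → y t ∈ Y := fun j' h => Nat.find_min hQ (hj ▸ h)
  -- If one vertex cut off the whole run, then adding `y k` to `Y` would cost one more boundary
  -- vertex and give a longer run.
  obtain ⟨j, rfl⟩ : ∃ j', j = j' + 1 := by
    refine ⟨j - 1, (Nat.succ_pred_eq_of_pos (Nat.pos_of_ne_zero ?_)).symm⟩
    intro h0
    refine hnot ⟨Y ∪ {y k}, by simp [hcY, (hc _).symm], ?_, fun t ht => ?_⟩
    · have := card_inBoundary_union_add_inter_le (D := D) Y {y k}
      have := card_inBoundary_singleton_le (D := D) (y k)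
      omega
    · rcases Nat.lt_or_ge t k with h' | h'
      · exact Finset.mem_union_left _ (hY t (by omega) h')
      · obtain rfl : t = k := by omega
        simp
  have huY : y j ∉ Y := fun h => hmin j (by omega) ⟨Y, hcY, hY1, fun t h1 h2 => by
    rcases Nat.eq_or_lt_of_le h1 with rfl | h1
    · exact h
    · exact hY t h1 h2⟩
  have hvY : ∀ x ∈ D.inBoundary Y, x = y (j + 1) := by
    intro x hx
    exact Finset.card_le_one.1 hY1 x hx _
      (mem_inBoundary.2 ⟨hY _ le_rfl (by omega), _, huY, hz j⟩)
  have hextend : ∀ Z : Finset V, c ∉ Z → y k ∈ Z → (D.inBoundary (X ∪ Z)).card ≤ 2 → False := by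
    intro Z hcZ hkZ h2
    refine hnot ⟨X ∪ Z, by simp [hcX, hcZ], h2, fun t ht => ?_⟩
    rcases Nat.lt_or_ge t k with h' | h'
    · exact Finset.mem_union_left _ (hX t h')
    · obtain rfl : t = k := by omega
      exact Finset.mem_union_right _ hkZ
  have hlast : y (k - 1) ∈ Y := hY _ (by omega) (by omega)
  refine ⟨y (j + 1), y j, y k, (hc _).symm, (hc _).symm, (hc _).symm, ?_, hz j, ?_,
    y (k - 1), ?_, ?_, ?_⟩
  -- Uncrossing. If `Z` contains `u`, `v`, `w` and has at most two boundary vertices, then either `X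
  -- ∩ Z` has boundary at most one, and its union with `Y` contradicts the minimality of `j`; or `X
  -- ∪ Z` has boundary at most two and contains the run together with `y k`.
  · intro a b _ _
    by_contra! h
    obtain ⟨Z, hZ, hcZ, hab⟩ := exists_finset_not_reachAvoiding D a b c
    have hZ2 := Finset.card_le_two_of_forall_eq_or hab
    have hu := (hZ _).2 h.1
    have hv := (hZ _).2 h.2.1
    have hw := (hZ _).2 h.2.2
    have hXZ := card_inBoundary_union_add_inter_le (D := D) X Z
    by_cases h1 : (D.inBoundary (X ∩ Z)).card ≤ 1
    · refine hmin j (by omega) ⟨(X ∩ Z) ∪ Y, by simp [hcX, hcY], ?_, fun t h1 h2 => ?_⟩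
      · have h3 := card_inBoundary_union_add_inter_le (D := D) (X ∩ Z) Y
        have h4 := hpos (X ∩ Z ∩ Y) (j + 1) (by simp [hcX])
          (by simp only [Finset.mem_inter]
              exact ⟨⟨hX _ (by omega), hv⟩, hY _ le_rfl (by omega)⟩)
        omega
      · rcases Nat.eq_or_lt_of_le h1 with rfl | h1
        · exact Finset.mem_union_left _ (Finset.mem_inter.2 ⟨hX _ h2, hu⟩)
        · exact Finset.mem_union_right _ (hY t h1 h2)
    · exact hextend Z hcZ hw (by omega)
  -- Go on around the cycle from `y k` to `y (j + L)`, stopping just before `v` recurs at `j + 1 +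
  -- L`.
  · have := reachAvoiding_along hz (a := c) (b := y (j + 1)) k (L + j - k) (by
      intro t h1 h2
      refine ⟨hc t, fun h => ?_⟩
      have h3 := hinj _ _ h
      have h4 := (Nat.modEq_iff_dvd' (by omega : j + 1 ≤ t)).1 h3.symm
      have := Nat.le_of_dvd (by omega) h4
      omega)
    rwa [show k + (L + j - k) = j + L by omega, hper] at this
  · have := hz (k - 1)
    rwa [show k - 1 + 1 = k by omega] at this
  · have := reachAvoiding_along hz (a := c) (b := c) (j + 1) (k - 1 - (j + 1))
      fun t _ _ => ⟨hc t, hc t⟩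
    rwa [show j + 1 + (k - 1 - (j + 1)) = k - 1 by omega] at this
  · exact not_reachAvoiding_of_inBoundary_subset hcY (fun x hx => Or.inl (hvY x hx)) hlast

end CycleToWitness

end Digraph

/-! ### From a witness to a three-linked dicycle -/

namespace Digraph

variable {V : Type*}

/-- The vertices in `C` form a dicycle, in this order. -/
structure IsDicycle (D : Digraph V) (C : List V) : Prop where
  nodup : C.Nodup
  isChain : C.IsChain D.Adj
  closed : ∀ a ∈ C.getLast?, ∀ b ∈ C.head?, D.Adj a b

theorem IsDicycle.rotate {D : Digraph V} {s t : List V} (h : D.IsDicycle (s ++ t)) :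
    D.IsDicycle (t ++ s) := by
  rcases List.eq_nil_or_concat s with rfl | ⟨s, x, rfl⟩
  · simpa using h
  rcases t with _ | ⟨y, t⟩
  · simpa using h
  obtain ⟨h1, h2, h3⟩ := h
  rw [List.isChain_append] at h2
  refine ⟨List.nodup_append_comm.1 h1, ?_, ?_⟩
  · rw [List.isChain_append]
    refine ⟨h2.2.1, h2.1, fun a ha b hb => h3 a ?_ b ?_⟩
    · simp only [Option.mem_def] at ha
      simp [ha]
    · simp only [Option.mem_def] at hb
      cases s <;> simpa using hb
  · intro a ha b hb
    rw [List.concat_eq_append, ← List.append_assoc, List.getLast?_concat] at ha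
    simp at ha hb h2
    subst ha hb
    exact h2.2.2

theorem exists_nodup_isChain_of_reflTransGen {r : V → V → Prop} {a b : V}
    (h : Relation.ReflTransGen r a b) :
    ∃ l : List V, l.IsChain r ∧ l.Nodup ∧ l.head? = some a ∧ l.getLast? = some b ∧
      ∀ y ∈ l, y = a ∨ ∃ x, r x y := by
  induction h with
  | refl => exact ⟨[a], by simp⟩
  | @tail b b' _ hb ih =>
    obtain ⟨l, h1, h2, h3, h4, h5⟩ := ih
    by_cases hmem : b' ∈ l
    · obtain ⟨s, t, rfl⟩ := List.append_of_mem hmem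
      have hp : s ++ [b'] <+: s ++ b' :: t := ⟨t, by simp⟩
      refine ⟨s ++ [b'], h1.prefix hp, h2.sublist hp.sublist, ?_, by simp, ?_⟩
      · cases s <;> simpa using h3
      · exact fun y hy => h5 y (hp.subset hy)
    · refine ⟨l ++ [b'], ?_, ?_, ?_, by simp, ?_⟩
      · rw [List.isChain_append]
        refine ⟨h1, by simp, ?_⟩
        simpa [h4] using hb
      · rw [List.nodup_append]
        refine ⟨h2, by simp, ?_⟩
        rintro x hx y hy rfl
        simp at hy
        exact hmem (hy ▸ hx)
      · simp [h3]
      · intro y hy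
        rcases List.mem_append.1 hy with hy | hy
        · exact h5 y hy
        · simp at hy
          exact Or.inr ⟨b, hy ▸ hb⟩

/-- A witness yields a dicycle to which the centre is linked by a fan of size three. -/
theorem IsWheelWitness.exists_isDicycle [Fintype V] {D : Digraph V} {c v u w : V}
    (h : D.IsWheelWitness c v u w) :
    ∃ C : List V, D.IsDicycle C ∧ c ∉ C ∧ D.IsThreeLinked c C := by
  obtain ⟨hv, hu, hw, hlink, huv, hwu, x, hxw, hvx, hx⟩ := h
  -- Restart the walk whenever it returns to `v`. After its last visit to `v` it cannot meet a
  -- vertex that `c` reaches without `v`, since then `c` would reach `x` too.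
  have h1 : Relation.ReflTransGen
      (fun x y => D.Adj x y ∧ y ≠ c ∧ ¬ D.ReachAvoiding v v c y) v x := by
    clear hxw
    induction hvx with
    | refl => exact Relation.ReflTransGen.refl
    | @tail x' x _ hs ih =>
      by_cases hxv : x = v
      · rw [hxv]
      · exact (ih fun hr => hx (hr.tail ⟨hs.1, hxv, hxv⟩)).tail ⟨hs.1, hs.2.1, hx⟩
  -- The linkage for the pair `u`, `v` must be realized by `w`, because a walk from `c` cannot end
  -- in a forbidden vertex.
  have hwr : D.ReachAvoiding u v c w := by
    rcases hlink u v hu.symm hv.symm with h | h | h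
    · rcases h.cases_tail with h | ⟨_, _, h⟩
      · exact absurd h.symm hu
      · exact absurd rfl h.2.1
    · rcases h.cases_tail with h | ⟨_, _, h⟩
      · exact absurd h.symm hv
      · exact absurd rfl h.2.2
    · exact h
  replace hwr : D.ReachAvoiding v v c w :=
    Relation.ReflTransGen.mono (fun _ _ h => ⟨h.1, h.2.2, h.2.2⟩) _ _ hwr
  have h2 : Relation.ReflTransGen
      (fun x y => D.Adj x y ∧ y ≠ c ∧ D.ReachAvoiding v v c y) w u ∧
      D.ReachAvoiding v v c u := by
    clear hlink hu huv
    induction hwu with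
    | refl => exact ⟨Relation.ReflTransGen.refl, hwr⟩
    | @tail x' x _ hs ih =>
      have := ih.2.tail ⟨hs.1, hs.2.2, hs.2.2⟩
      exact ⟨ih.1.tail ⟨hs.1, hs.2.1, this⟩, this⟩
  obtain ⟨s, hs1, hs2, hs3, hs4, hs5⟩ := exists_nodup_isChain_of_reflTransGen h1
  obtain ⟨t, ht1, ht2, ht3, ht4, ht5⟩ := exists_nodup_isChain_of_reflTransGen h2.1
  have hvv : ¬ D.ReachAvoiding v v c v := by
    intro h
    rcases h.cases_tail with h | ⟨_, _, h⟩
    · exact hv h.symm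
    · exact h.2.1 rfl
  have hs : ∀ y ∈ s, y ≠ c ∧ ¬ D.ReachAvoiding v v c y := by
    intro y hy
    rcases hs5 y hy with rfl | ⟨_, h⟩
    · exact ⟨hv.symm, hvv⟩
    · exact h.2
  have ht : ∀ y ∈ t, y ≠ c ∧ D.ReachAvoiding v v c y := by
    intro y hy
    rcases ht5 y hy with rfl | ⟨_, h⟩
    · exact ⟨hw.symm, hwr⟩
    · exact h.2
  refine ⟨s ++ t, ⟨?_, ?_, ?_⟩, ?_, ?_⟩
  · rw [List.nodup_append]
    refine ⟨hs2, ht2, ?_⟩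
    rintro a ha b hb rfl
    exact (hs a ha).2 (ht a hb).2
  · rw [List.isChain_append]
    refine ⟨hs1.imp fun _ _ h => h.1, ht1.imp fun _ _ h => h.1, ?_⟩
    simpa [hs4, ht3] using hxw
  · simpa [hs3, ht4] using huv
  · intro h
    rcases List.mem_append.1 h with h | h
    · exact (hs c h).1 rfl
    · exact (ht c h).1 rfl
  · have hvs : v ∈ s := List.mem_of_mem_head? hs3
    refine isThreeLinked_of_reachAvoiding (by rintro h; simp at h; simp [h.1] at hvs) ?_
    intro a b ha hb
    rcases hlink a b ha hb with h | h | h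
    · exact ⟨u, List.mem_append_right _ (List.mem_of_mem_getLast? ht4), h⟩
    · exact ⟨v, List.mem_append_left _ hvs, h⟩
    · exact ⟨w, List.mem_append_right _ (List.mem_of_mem_head? ht3), h⟩

/-! ### Menger's theorem for fans, from Hall's theorem -/

theorem isChain_map_range {r : V → V → Prop} (g : ℕ → V) (m : ℕ)
    (h : ∀ k, k + 1 < m → r (g k) (g (k + 1))) : ((List.range m).map g).IsChain r := by
  rw [List.isChain_map, List.isChain_range]
  exact fun k hk => h k (by omega)

/-- The relation whose perfect matchings are the fans of size three from `c` to `l`: an element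
of `V` that is matched with itself is unused, and a fan is left at its first element of `l`. -/
def FanRel (D : Digraph V) (c : V) (l : List V) : V ⊕ Fin 3 → V ⊕ Fin 3 → Prop
  | .inl x, .inl y => y = x ∨ (x ≠ c ∧ x ∉ l ∧ D.Adj x y)
  | .inl x, .inr _ => x ∈ l
  | .inr _, .inl y => D.Adj c y
  | .inr _, .inr _ => False

/-- Hall's condition for `A`: if `A` has no copy of the source or meets `l`, then each element of
`A` is itself a neighbour of `A`. Otherwise the complement of `A ∪ {c}` contains `l`, and its
boundary supplies three further neighbours, which pay for the at most three source copies in `A`. -/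
theorem exists_injective_fanRel [Fintype V] {D : Digraph V} {c : V} {l : List V}
    (h : D.IsThreeLinked c l) (hc : c ∉ l) :
    ∃ f : V ⊕ Fin 3 → V ⊕ Fin 3, Function.Injective f ∧ ∀ x, D.FanRel c l x (f x) := by
  classical
  rw [← Fintype.all_card_le_filter_rel_iff_exists_injective]
  intro A
  by_cases hA : ∀ i, Sum.inr i ∈ A → ∃ x ∈ l, Sum.inl x ∈ A
  · refine Finset.card_le_card fun y hy => ?_
    simp only [Finset.mem_filter, Finset.mem_univ, true_and]
    rcases y with x | i
    · exact ⟨_, hy, Or.inl rfl⟩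
    · obtain ⟨x, hx, hxA⟩ := hA i hy
      exact ⟨_, hxA, hx⟩
  · push Not at hA
    obtain ⟨i, hi, hl⟩ := hA
    let W : Finset V := Finset.univ.filter fun x => Sum.inl x ∈ A
    have hX := h (insert c W)ᶜ (by simp) (fun y hy => by
      simp only [Finset.mem_compl, Finset.mem_insert, not_or]
      exact ⟨fun h => hc (h ▸ hy), by simpa [W] using hl y hy⟩)
    have h1 : A.card ≤ W.card + 3 := by
      calc A.card ≤ (W.map .inl ∪ (Finset.univ : Finset (Fin 3)).map .inr).card := by
            refine Finset.card_le_card fun y hy => ?_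
            rcases y with x | i <;> simp [W, hy]
        _ ≤ _ := (Finset.card_union_le _ _).trans (by simp)
    have h2 : Disjoint W (D.inBoundary (insert c W)ᶜ) := by
      rw [Finset.disjoint_left]
      intro x hx hx'
      have := inBoundary_subset _ hx'
      simp [hx] at this
    calc A.card ≤ W.card + (D.inBoundary (insert c W)ᶜ).card := by omega
      _ = ((W ∪ D.inBoundary (insert c W)ᶜ).map .inl : Finset (V ⊕ Fin 3)).card := by
        rw [Finset.card_map, Finset.card_union_of_disjoint h2]
      _ ≤ _ := by
        refine Finset.card_le_card fun y hy => ?_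
        obtain ⟨x, hx, rfl⟩ := Finset.mem_map.1 hy
        simp only [Finset.mem_filter, Finset.mem_univ, true_and]
        rcases Finset.mem_union.1 hx with hx | hx
        · exact ⟨Sum.inl x, by simpa [W] using hx, Or.inl rfl⟩
        · obtain ⟨_, y, hy, hyx⟩ := mem_inBoundary.1 hx
          by_cases hyc : y = c
          · exact ⟨_, hi, hyc ▸ hyx⟩
          · have hyW : Sum.inl y ∈ A := by simpa [hyc, W] using hy
            exact ⟨_, hyW, Or.inr ⟨hyc, fun h => hl y h hyW, hyx⟩⟩

/-- An injection of a finite set is a permutation, so the orbit of a source copy returns to a source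
copy, and it can do so only from an element of `l`. -/
theorem exists_orbit_of_injective_fanRel [Fintype V] {D : Digraph V} {c : V} {l : List V}
    {f : V ⊕ Fin 3 → V ⊕ Fin 3} (hf : Function.Injective f) (hr : ∀ x, D.FanRel c l x (f x))
    (i : Fin 3) :
    ∃ (m : ℕ) (g : ℕ → V), (∀ k ≤ m, f^[k + 1] (.inr i) = .inl (g k)) ∧ g m ∈ l := by
  classical
  have hex : ∃ m, ∃ j, f^[m + 1] (Sum.inr i) = Sum.inr j := by
    obtain ⟨n, hn, h⟩ := Function.mem_periodicPts.1 (hf.mem_periodicPts (Sum.inr i))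
    exact ⟨n - 1, i, by rwa [Nat.sub_add_cancel hn]⟩
  obtain ⟨m, hm⟩ : ∃ m, Nat.find hex = m := ⟨_, rfl⟩
  obtain ⟨j, hj⟩ := hm ▸ Nat.find_spec hex
  have hmin : ∀ k < m, ∃ x, f^[k + 1] (Sum.inr i) = Sum.inl x := by
    intro k hk
    have := Nat.find_min hex (hm ▸ hk)
    rcases h : f^[k + 1] (Sum.inr i) with x | j
    · exact ⟨x, rfl⟩
    · exact absurd ⟨j, h⟩ this
  obtain ⟨m, rfl⟩ : ∃ m', m = m' + 1 := by
    refine ⟨m - 1, (Nat.succ_pred_eq_of_pos (Nat.pos_of_ne_zero ?_)).symm⟩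
    rintro rfl
    have := hr (.inr i)
    rw [zero_add, Function.iterate_one] at hj
    rw [hj] at this
    exact this
  have : ∀ k, ∃ x, k ≤ m → f^[k + 1] (Sum.inr i) = Sum.inl x := by
    intro k
    by_cases hk : k ≤ m
    · obtain ⟨x, hx⟩ := hmin k (by omega)
      exact ⟨x, fun _ => hx⟩
    · exact ⟨c, fun h => absurd h hk⟩
  choose g hg using this
  refine ⟨m, g, hg, ?_⟩
  have := hr (f^[m + 1] (.inr i))
  rw [← Function.iterate_succ_apply' f, hj, hg m le_rfl] at this
  exact this

/-- Menger's theorem for fans of size three. -/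
theorem IsThreeLinked.exists_fan [Fintype V] {D : Digraph V} {c : V} {l : List V}
    (h : D.IsThreeLinked c l) (hc : c ∉ l) :
    ∃ (e : Fin 3 → V) (q : Fin 3 → List V), Function.Injective e ∧ (∀ i, e i ∈ l) ∧
      (∀ i, List.IsChain D.Adj (c :: (q i ++ [e i])) ∧ (q i).Nodup ∧
        ∀ x ∈ q i, x ≠ c ∧ x ∉ l) ∧
      ∀ i j, i ≠ j → List.Disjoint (q i) (q j) := by
  obtain ⟨f, hf, hr⟩ := exists_injective_fanRel h hc
  choose m g hg hm using exists_orbit_of_injective_fanRel hf hr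
  -- Cancelling `k + 1` iterations of `f` leaves a source copy on one side, which no `k' - k > 0`
  -- steps from `j` can reach.
  have hle : ∀ i j k k', k ≤ m i → k' ≤ m j → k ≤ k' → g i k = g j k' → i = j ∧ k = k' := by
    intro i j k k' hk hk' hkk heq
    have h1 : f^[k + 1] (Sum.inr i) = f^[k + 1] (f^[k' - k] (Sum.inr j)) := by
      rw [hg i k hk, ← Function.iterate_add_apply, show k + 1 + (k' - k) = k' + 1 by omega,
        hg j k' hk', heq]
    have h2 := hf.iterate (k + 1) h1
    rcases Nat.eq_zero_or_pos (k' - k) with h0 | h0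
    · rw [h0] at h2
      simp at h2
      exact ⟨h2, by omega⟩
    · rw [show k' - k = k' - k - 1 + 1 by omega, hg j _ (by omega)] at h2
      simp at h2
  have hinj : ∀ i j k k', k ≤ m i → k' ≤ m j → g i k = g j k' → i = j ∧ k = k' := by
    intro i j k k' hk hk' heq
    rcases le_total k k' with h | h
    · exact hle i j k k' hk hk' h heq
    · obtain ⟨h1, h2⟩ := hle j i k' k hk' hk h heq.symm
      exact ⟨h1.symm, h2.symm⟩
  have hstep : ∀ i k, k + 1 ≤ m i →
      g i k ≠ c ∧ g i k ∉ l ∧ D.Adj (g i k) (g i (k + 1)) := by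
    intro i k hk
    have := hr (f^[k + 1] (.inr i))
    rw [← Function.iterate_succ_apply' f, hg i (k + 1) hk, hg i k (by omega)] at this
    rcases this with h | h
    · have := (hinj i i _ _ hk (by omega) h).2
      omega
    · exact h
  refine ⟨fun i => g i (m i), fun i => (List.range (m i)).map (g i), ?_, hm, ?_, ?_⟩
  · exact fun i j h => (hinj i j _ _ le_rfl le_rfl h).1
  · refine fun i => ⟨?_, ?_, ?_⟩
    · have : (List.range (m i)).map (g i) ++ [g i (m i)] = (List.range (m i + 1)).map (g i) := by
        rw [List.range_succ, List.map_append]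
        rfl
      rw [this]
      refine List.IsChain.cons (isChain_map_range _ _ fun k hk => (hstep i k (by omega)).2.2) ?_
      have := hr (.inr i)
      have h0 := hg i 0 (Nat.zero_le _)
      rw [zero_add, Function.iterate_one] at h0
      rw [h0] at this
      simp only [List.range_succ_eq_map, List.map_cons, List.head?_cons, Option.mem_def,
        Option.some.injEq]
      rintro _ rfl
      exact this
    · refine List.Nodup.map_on (fun a ha b hb hab => ?_) List.nodup_range
      rw [List.mem_range] at ha hb
      exact (hinj i i a b ha.le hb.le hab).2
    · intro x hx
      obtain ⟨k, hk, rfl⟩ := List.mem_map.1 hx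
      rw [List.mem_range] at hk
      have := hstep i k hk
      exact ⟨this.1, this.2.1⟩
  · intro i j hij x hx hx'
    obtain ⟨k, hk, rfl⟩ := List.mem_map.1 hx
    obtain ⟨k', hk', h⟩ := List.mem_map.1 hx'
    rw [List.mem_range] at hk hk'
    exact hij (hinj i j k k' hk.le hk'.le h.symm).1

end Digraph

/-! ### Subdivisions of the wheel as a dicycle with a fan -/

namespace Digraph

variable {V : Type*}

theorem containsSubdivision_wheel3_of_fan {D : Digraph V} {c : V} {e : Fin 3 → V}
    {q σ : Fin 3 → List V} (he : Function.Injective e) (hec : ∀ i, e i ≠ c)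
    (hq : ∀ i, List.IsChain D.Adj (c :: (q i ++ [e i])) ∧ (q i).Nodup ∧
      ∀ x ∈ q i, x ≠ c ∧ ∀ j, x ≠ e j)
    (hσ : ∀ i, List.IsChain D.Adj (e i :: (σ i ++ [e (i + 1)])) ∧ (σ i).Nodup ∧
      ∀ x ∈ σ i, x ≠ c ∧ ∀ j, x ≠ e j)
    (hqq : ∀ i j, i ≠ j → List.Disjoint (q i) (q j))
    (hσσ : ∀ i j, i ≠ j → List.Disjoint (σ i) (σ j))
    (hqσ : ∀ i j, List.Disjoint (q i) (σ j)) : D.ContainsSubdivision wheel3 := by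
  refine ⟨fun o => o.elim c e, fun o o' => o.elim (o'.elim [] q) σ, ?_, ?_, ?_⟩
  · rintro (_ | i) (_ | j) h
    · rfl
    · exact absurd h.symm (hec j)
    · exact absurd h (hec i)
    · exact congrArg some (he h)
  · rintro (_ | i) (_ | j) h
    · exact h.elim
    · refine ⟨(hq j).1, (hq j).2.1, ?_⟩
      rintro x hx ⟨_ | k, rfl⟩
      · exact ((hq j).2.2 _ hx).1 rfl
      · exact ((hq j).2.2 _ hx).2 k rfl
    · exact h.elim
    · obtain rfl : j = i + 1 := h
      refine ⟨(hσ i).1, (hσ i).2.1, ?_⟩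
      rintro x hx ⟨_ | k, rfl⟩
      · exact ((hσ i).2.2 _ hx).1 rfl
      · exact ((hσ i).2.2 _ hx).2 k rfl
  · rintro (_ | i) (_ | j) (_ | i') (_ | j') h h' hne
    all_goals first | exact h.elim | exact h'.elim | skip
    · exact hqq j j' (by rintro rfl; exact hne rfl)
    · exact hqσ j i'
    · exact (hqσ j' i).symm
    · refine hσσ i i' ?_
      rintro rfl
      obtain rfl : j = i + 1 := h
      obtain rfl : j' = i + 1 := h'
      exact hne rfl

theorem containsSubdivision_wheel3_of_isDicycle_append {D : Digraph V} {c : V} {e : Fin 3 → V}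
    {q : Fin 3 → List V} {s t r : List V}
    (hC : D.IsDicycle (e 0 :: s ++ (e 1 :: t ++ (e 2 :: r))))
    (hc : c ∉ e 0 :: s ++ (e 1 :: t ++ (e 2 :: r)))
    (hq : ∀ i, List.IsChain D.Adj (c :: (q i ++ [e i])) ∧ (q i).Nodup ∧
      ∀ x ∈ q i, x ≠ c ∧ x ∉ e 0 :: s ++ (e 1 :: t ++ (e 2 :: r)))
    (hqq : ∀ i j, i ≠ j → List.Disjoint (q i) (q j)) : D.ContainsSubdivision wheel3 := by
  obtain ⟨hn, hch, hcl⟩ := hC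
  have hcl' : ∀ a ∈ (e 2 :: r).getLast?, D.Adj a (e 0) := by
    intro a ha
    refine hcl a ?_ (e 0) (by simp)
    rw [List.getLast?_append_of_ne_nil _ (by simp), List.getLast?_append_of_ne_nil _ (by simp)]
    exact ha
  rw [List.isChain_append, List.isChain_append] at hch
  obtain ⟨h0, ⟨h1, h2, h3⟩, h4⟩ := hch
  simp only [List.cons_append, List.nodup_cons, List.mem_append, List.mem_cons, not_or,
    List.nodup_append, List.mem_append, ne_eq] at hn hc hq
  obtain ⟨⟨hs0, h01, ht0, h02, hr0⟩, hns, ⟨⟨ht1, h12, hr1⟩, hnt, ⟨hr2, hnr⟩, htr⟩, hst⟩ := hn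
  obtain ⟨hc0, hcs, hc1, hct, hc2, hcr⟩ := hc
  have hfin : ∀ {P : Fin 3 → Prop}, P 0 → P 1 → P 2 → ∀ i, P i := by
    intro P h0 h1 h2 i
    fin_cases i
    exacts [h0, h1, h2]
  have hne : ∀ {x y : V} {l : List V}, y ∉ l → x ∈ l → x ≠ y := fun h hx h' => h (h' ▸ hx)
  have hs : ∀ x ∈ s, x ≠ c ∧ ∀ j, x ≠ e j := fun x hx =>
    ⟨hne hcs hx, hfin (hne hs0 hx) (hst x hx _ (by simp)) (hst x hx _ (by simp))⟩
  have ht : ∀ x ∈ t, x ≠ c ∧ ∀ j, x ≠ e j := fun x hx =>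
    ⟨hne hct hx, hfin (hne ht0 hx) (hne ht1 hx) (htr x hx _ (by simp))⟩
  have hr : ∀ x ∈ r, x ≠ c ∧ ∀ j, x ≠ e j := fun x hx =>
    ⟨hne hcr hx, hfin (hne hr0 hx) (hne hr1 hx) (hne hr2 hx)⟩
  have dst : List.Disjoint s t := fun x hx hx' => hst x hx x (by simp [hx']) rfl
  have dsr : List.Disjoint s r := fun x hx hx' => hst x hx x (by simp [hx']) rfl
  have dtr : List.Disjoint t r := fun x hx hx' => htr x hx x (by simp [hx']) rfl
  refine containsSubdivision_wheel3_of_fan (c := c) (e := e) (q := q) (σ := ![s, t, r])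
    ?_ (hfin (Ne.symm hc0) (Ne.symm hc1) (Ne.symm hc2)) ?_ (hfin ?_ ?_ ?_) hqq ?_ ?_
  · refine hfin (hfin ?_ ?_ ?_) (hfin ?_ ?_ ?_) (hfin ?_ ?_ ?_) <;> intro h <;>
      first | rfl | exact absurd h ‹_› | exact absurd h.symm ‹_›
  · refine fun i => ⟨(hq i).1, (hq i).2.1, fun x hx => ⟨((hq i).2.2 x hx).1, ?_⟩⟩
    obtain ⟨_, h0, _, h1, _, h2, _⟩ := (hq i).2.2 x hx
    exact hfin h0 h1 h2
  · refine ⟨?_, hns, hs⟩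
    rw [← List.cons_append, List.isChain_append]
    exact ⟨h0, by simp, by simpa using h4⟩
  · refine ⟨?_, hnt, ht⟩
    rw [← List.cons_append, List.isChain_append]
    exact ⟨h1, by simp, by simpa using h3⟩
  · refine ⟨?_, hnr, hr⟩
    rw [← List.cons_append, List.isChain_append]
    exact ⟨h2, by simp, by simpa using hcl'⟩
  · refine hfin (hfin ?_ ?_ ?_) (hfin ?_ ?_ ?_) (hfin ?_ ?_ ?_) <;> intro h <;>
      first | exact absurd rfl h | assumption | exact List.Disjoint.symm ‹_›
  · refine fun i => hfin ?_ ?_ ?_ <;> intro x hx hx' <;>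
      obtain ⟨_, _, hxs, _, hxt, _, hxr⟩ := (hq i).2.2 x hx
    exacts [hxs hx', hxt hx', hxr hx']

theorem IsDicycle.containsSubdivision_wheel3 [Fintype V] {D : Digraph V} {c : V} {C : List V}
    (hC : D.IsDicycle C) (hc : c ∉ C) (hl : D.IsThreeLinked c C) :
    D.ContainsSubdivision wheel3 := by
  obtain ⟨e, q, he, heC, hq, hqq⟩ := hl.exists_fan hc
  clear hl
  obtain ⟨s, t, rfl⟩ := List.append_of_mem (heC 0)
  replace hC := hC.rotate
  have hmem : ∀ x, x ∈ s ++ e 0 :: t ↔ x ∈ e 0 :: t ++ s := by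
    intro x
    simp only [List.mem_append]
    tauto
  simp only [hmem] at hc heC hq
  clear hmem
  rw [List.cons_append] at *
  generalize t ++ s = l at *
  have hne : ∀ i j, i ≠ j → e i ≠ e j := fun i j h h' => h (he h')
  have hm : ∀ i, i ≠ 0 → e i ∈ l := fun i hi =>
    (List.mem_cons.1 (heC i)).resolve_left (hne i 0 hi)
  obtain ⟨a, b, rfl⟩ := List.append_of_mem (hm 1 (by decide))
  have h2 := hm 2 (by decide)
  simp only [List.mem_append, List.mem_cons, hne 2 1 (by decide), false_or] at h2
  rcases h2 with h2 | h2
  · obtain ⟨a, a', rfl⟩ := List.append_of_mem h2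
    -- The fan may reach the cycle in the opposite cyclic order; relabelling its paths corrects
    -- this.
    refine containsSubdivision_wheel3_of_isDicycle_append (c := c) (e := e ∘ ![0, 2, 1])
      (q := q ∘ ![0, 2, 1]) (s := a) (t := a') (r := b) ?_ ?_ ?_ ?_
    · simpa using hC
    · simpa using hc
    · intro i
      have := hq (![0, 2, 1] i)
      simpa using this
    · intro i j hij
      apply hqq
      fin_cases i <;> fin_cases j <;> simp at hij ⊢
  · obtain ⟨b, b', rfl⟩ := List.append_of_mem h2
    refine containsSubdivision_wheel3_of_isDicycle_append (c := c) (e := e)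
      (q := q) (s := a) (t := b) (r := b') ?_ ?_ ?_ hqq
    · simpa using hC
    · simpa using hc
    · intro i
      simpa using hq i

theorem exists_mem_inBoundary_of_isChain [Fintype V] {D : Digraph V} {X : Finset V} {c : V}
    {l : List V} (h : List.IsChain D.Adj (c :: l)) (hc : c ∉ X) (hl : ∃ y ∈ l, y ∈ X) :
    ∃ x ∈ l, x ∈ D.inBoundary X := by
  induction l generalizing c with
  | nil => simp at hl
  | cons a l ih =>
    rw [List.isChain_cons_cons] at h
    by_cases ha : a ∈ X
    · exact ⟨a, by simp, mem_inBoundary.2 ⟨ha, c, hc, h.1⟩⟩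
    · obtain ⟨x, hx, hx'⟩ := ih h.2 ha (by simpa [ha] using hl)
      exact ⟨x, List.mem_cons_of_mem _ hx, hx'⟩

/-- The cycle is the subdivided rim. Each subdivided spoke enters a set containing the rim but not
the centre, and the three entry vertices are distinct because the spokes share only the centre. -/
theorem exists_isDicycle_of_containsSubdivision [Fintype V] {D : Digraph V}
    (h : D.ContainsSubdivision wheel3) :
    ∃ (c : V) (C : List V), C ≠ [] ∧ D.IsDicycle C ∧ c ∉ C ∧ D.IsThreeLinked c C := by
  obtain ⟨f, p, hf, hp, hd⟩ := h
  have hrim : ∀ i : Fin 3, wheel3.Adj (some i) (some (i + 1)) := fun i => rfl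
  have hspoke : ∀ i : Fin 3, wheel3.Adj none (some i) := fun i => trivial
  have hne : ∀ o o', o ≠ o' → f o ≠ f o' := fun o o' h h' => h (hf h')
  have hdr : ∀ i j : Fin 3, i ≠ j →
      List.Disjoint (p (some i) (some (i + 1))) (p (some j) (some (j + 1))) :=
    fun i j hij => hd _ _ _ _ (hrim i) (hrim j) (by simp [hij])
  obtain ⟨c0, n0, m0⟩ := hp _ _ (hrim 0)
  obtain ⟨c1, n1, m1⟩ := hp _ _ (hrim 1)
  obtain ⟨c2, n2, m2⟩ := hp _ _ (hrim 2)
  have d01 := hdr 0 1 (by decide)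
  have d02 := hdr 0 2 (by decide)
  have d12 := hdr 1 2 (by decide)
  simp only [show (0 : Fin 3) + 1 = 1 from rfl, show (1 : Fin 3) + 1 = 2 from rfl,
    show (2 : Fin 3) + 1 = 0 from rfl] at c0 n0 m0 c1 n1 m1 c2 n2 m2 d01 d02 d12
  have hlink : ∀ X : Finset V, f none ∉ X → (∀ i : Fin 3, f (some i) ∈ X) →
      3 ≤ (D.inBoundary X).card := by
    intro X hc hX
    have : ∀ i : Fin 3, ∃ x ∈ p none (some i) ++ [f (some i)], x ∈ D.inBoundary X := fun i =>
      exists_mem_inBoundary_of_isChain (hp _ _ (hspoke i)).1 hc ⟨f (some i), by simp, hX i⟩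
    choose x hx hxX using this
    have hinj : Function.Injective x := by
      intro i j hij
      by_contra hne'
      have h1 := hx i
      have h2 := hx j
      rw [← hij] at h2
      simp only [List.mem_append, List.mem_singleton] at h1 h2
      rcases h1 with h1 | h1 <;> rcases h2 with h2 | h2
      · exact hd _ _ _ _ (hspoke i) (hspoke j) (by simp [hne']) h1 h2
      · exact (hp _ _ (hspoke i)).2.2 _ h1 ⟨_, h2.symm⟩
      · exact (hp _ _ (hspoke j)).2.2 _ h2 ⟨_, h1.symm⟩
      · exact hne _ _ (by simpa using hne') (h1.symm.trans h2)
    have := Finset.card_le_card_of_injOn (s := Finset.univ) (t := D.inBoundary X) x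
      (fun i _ => hxX i) hinj.injOn
    simpa using this
  refine ⟨f none, f (some 0) :: p (some 0) (some 1) ++ (f (some 1) :: p (some 1) (some 2) ++
    (f (some 2) :: p (some 2) (some 0))), by simp, ⟨?_, ?_, ?_⟩, ?_, ?_⟩
  · have e01 := hne (some 0) (some 1) (by decide)
    have e02 := hne (some 0) (some 2) (by decide)
    have e12 := hne (some 1) (some 2) (by decide)
    have m : ∀ o, f o ∈ Set.range f := fun o => ⟨o, rfl⟩
    simp only [List.cons_append, List.nodup_cons, List.mem_append, List.mem_cons, not_or,
      List.nodup_append, ne_eq]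
    have m0' := fun o h => m0 (f o) h (m o)
    have m1' := fun o h => m1 (f o) h (m o)
    have m2' := fun o h => m2 (f o) h (m o)
    simp only [List.Disjoint] at d01 d02 d12
    grind
  · rw [List.isChain_append, List.isChain_append]
    rw [← List.cons_append, List.isChain_append] at c0 c1 c2
    simp only [List.head?_cons, List.cons_append] at c0 c1 c2 ⊢
    exact ⟨c0.1, ⟨c1.1, c2.1, c1.2.2⟩, c0.2.2⟩
  · rw [List.getLast?_append_of_ne_nil _ (by simp), List.getLast?_append_of_ne_nil _ (by simp)]
    rw [← List.cons_append, List.isChain_append] at c2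
    simpa using c2.2.2
  · have m : f none ∈ Set.range f := ⟨none, rfl⟩
    have e0 := hne none (some 0) (by decide)
    have e1 := hne none (some 1) (by decide)
    have e2 := hne none (some 2) (by decide)
    have m0' := fun h => m0 _ h m
    have m1' := fun h => m1 _ h m
    have m2' := fun h => m2 _ h m
    simp only [List.cons_append, List.mem_append, List.mem_cons, not_or]
    exact ⟨e0, m0', e1, m1', e2, m2'⟩
  · intro X hc hX
    refine hlink X hc fun i => hX _ ?_
    fin_cases i <;> simp

theorem IsDicycle.exists_isWheelWitness [Fintype V] {D : Digraph V} {c : V} {C : List V}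
    (h0 : C ≠ []) (hC : D.IsDicycle C) (hc : c ∉ C) (hl : D.IsThreeLinked c C) :
    ∃ v u w, D.IsWheelWitness c v u w := by
  have hL : 0 < C.length := List.length_pos_of_ne_nil h0
  have hlt : ∀ i, i % C.length < C.length := fun i => Nat.mod_lt _ hL
  refine exists_isWheelWitness_of_cycle (z := fun i => C[i % C.length]'(hlt i)) hL ?_ ?_ ?_ ?_ ?_
  · intro i
    rcases Nat.lt_or_ge (i % C.length + 1) C.length with h | h
    · have := List.isChain_iff_getElem.1 hC.isChain _ h
      have h' : (i + 1) % C.length = i % C.length + 1 := by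
        rw [← Nat.mod_add_mod, Nat.mod_eq_of_lt h]
      simp only [h']
      exact this
    · have h1 : i % C.length = C.length - 1 := by have := hlt i; omega
      have h' : (i + 1) % C.length = 0 := by
        rw [← Nat.mod_add_mod, h1, Nat.sub_add_cancel hL, Nat.mod_self]
      simp only [h', h1]
      refine hC.closed _ ?_ _ ?_
      · rw [List.getLast?_eq_getElem?]
        simp
      · rw [List.head?_eq_getElem?]
        simp [hL]
  · intro i
    simp
  · intro s t h
    exact (List.Nodup.getElem_inj_iff hC.nodup).1 h
  · intro i h
    exact hc (h ▸ List.getElem_mem _)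
  · intro X hcX hX
    refine hl X hcX fun y hy => ?_
    obtain ⟨i, hi, rfl⟩ := List.mem_iff_getElem.1 hy
    have := hX i
    simpa only [Nat.mod_eq_of_lt hi] using this

/-- Subdivisions of `wheel3` are characterized by reachability. -/
theorem containsSubdivision_wheel3_iff [Fintype V] {D : Digraph V} :
    D.ContainsSubdivision wheel3 ↔ ∃ c v u w, D.IsWheelWitness c v u w := by
  constructor
  · intro h
    obtain ⟨c, C, h0, hC, hc, hl⟩ := exists_isDicycle_of_containsSubdivision h
    exact ⟨c, hC.exists_isWheelWitness h0 hc hl⟩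
  · rintro ⟨c, v, u, w, h⟩
    obtain ⟨C, hC, hc, hl⟩ := h.exists_isDicycle
    exact hC.containsSubdivision_wheel3 hc hl

end Digraph

/-! ### Program logic with time bounds -/

namespace RAM

/-- Started with memory `s`, the program `P` halts within `T` steps in a memory that
satisfies `Q`. -/
def Runs (P : Program) (s : Memory) (T : ℕ) (Q : Memory → Prop) : Prop :=
  ∃ (t : ℕ) (s' : Memory), Exec P s t s' ∧ t ≤ T ∧ Q s'

section Rules

variable {P P' : Program} {s : Memory} {T T₁ T₂ : ℕ} {Q R : Memory → Prop}

theorem Runs.mono (h : Runs P s T₁ Q) (hT : T₁ ≤ T) (hQ : ∀ s', Q s' → R s') : Runs P s T R := by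
  obtain ⟨t, s', h1, h2, h3⟩ := h
  exact ⟨t, s', h1, h2.trans hT, hQ _ h3⟩

theorem runs_skip (h : Q s) (hT : 1 ≤ T) : Runs .skip s T Q :=
  ⟨1, s, .skip s, hT, h⟩

theorem runs_assign {i : ℕ} {e : Expr} (h : Q (s.setReg i (e.eval s))) (hT : e.cost + 1 ≤ T) :
    Runs (.assign i e) s T Q :=
  ⟨_, _, .assign i e s, hT, h⟩

theorem runs_store {a : ℕ} {e₁ e₂ : Expr} (h : Q (s.setArr a (e₁.eval s) (e₂.eval s)))
    (hT : e₁.cost + e₂.cost + 1 ≤ T) : Runs (.store a e₁ e₂) s T Q :=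
  ⟨_, _, .store a e₁ e₂ s, hT, h⟩

theorem Runs.seq (h : Runs P s T₁ fun s' => Runs P' s' T₂ Q) (hT : T₁ + T₂ ≤ T) :
    Runs (.seq P P') s T Q := by
  obtain ⟨t, s', h1, h2, t', s'', h3, h4, h5⟩ := h
  exact ⟨_, _, .seq h1 h3, by omega, h5⟩

theorem runs_assign_seq {i : ℕ} {e : Expr} (h : Runs P (s.setReg i (e.eval s)) T₁ Q)
    (hT : e.cost + 1 + T₁ ≤ T) : Runs (.seq (.assign i e) P) s T Q :=
  (runs_assign (Q := fun s' => Runs P s' T₁ Q) h le_rfl).seq hT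

theorem runs_store_seq {a : ℕ} {e₁ e₂ : Expr}
    (h : Runs P (s.setArr a (e₁.eval s) (e₂.eval s)) T₁ Q)
    (hT : e₁.cost + e₂.cost + 1 + T₁ ≤ T) : Runs (.seq (.store a e₁ e₂) P) s T Q :=
  (runs_store (Q := fun s' => Runs P s' T₁ Q) h le_rfl).seq hT

theorem runs_ite {e : Expr} (h : e.eval s ≠ 0 → Runs P s T₁ Q) (h' : e.eval s = 0 → Runs P' s T₁ Q)
    (hT : e.cost + 1 + T₁ ≤ T) : Runs (.ite e P P') s T Q := by
  by_cases he : e.eval s = 0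
  · obtain ⟨t, s', h1, h2, h3⟩ := h' he
    exact ⟨_, _, .ite_false he h1, by omega, h3⟩
  · obtain ⟨t, s', h1, h2, h3⟩ := h he
    exact ⟨_, _, .ite_true he h1, by omega, h3⟩

/-- The rule for loops: `Inv k` is the invariant when at most `k` further steps are needed until
the last evaluation of the test. -/
theorem runs_while {e : Expr} {Inv : ℕ → Memory → Prop}
    (h : ∀ k s, Inv k s → e.eval s ≠ 0 →
      ∃ T, Runs P s T fun s' => ∃ k', Inv k' s' ∧ e.cost + 1 + T + k' ≤ k)
    {k : ℕ} (h0 : Inv k s) (hT : k + e.cost + 1 ≤ T) (hQ : ∀ k s', Inv k s' → e.eval s' = 0 → Q s') :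
    Runs (.while e P) s T Q := by
  induction k using Nat.strong_induction_on generalizing s T with
  | _ k ih =>
    by_cases he : e.eval s = 0
    · exact ⟨_, _, .while_false he, by omega, hQ k s h0 he⟩
    · obtain ⟨T', t, s', h1, h2, k', h3, h4⟩ := h k s h0 he
      obtain ⟨t', s'', h5, h6, h7⟩ := ih k' (by omega) h3 le_rfl
      exact ⟨_, _, .while_true he h1 h5, by omega, h7⟩

end Rules

@[simp] theorem Memory.reg_setReg (s : Memory) (i x j : ℕ) :
    (s.setReg i x).reg j = if j = i then x else s.reg j := by
  simp [Memory.setReg, Function.update_apply]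

@[simp] theorem Memory.arr_setReg (s : Memory) (i x : ℕ) : (s.setReg i x).arr = s.arr := rfl

@[simp] theorem Memory.reg_setArr (s : Memory) (a j x : ℕ) : (s.setArr a j x).reg = s.reg := rfl

@[simp] theorem Memory.arr_setArr (s : Memory) (a j x b k : ℕ) :
    (s.setArr a j x).arr b k = if b = a ∧ k = j then x else s.arr b k := by
  by_cases hb : b = a
  · subst hb
    simp [Memory.setArr, Function.update_apply]
  · simp [Memory.setArr, hb]

attribute [simp] Expr.eval Expr.cost

theorem Expr.eval_lt_ne_zero {e₁ e₂ : Expr} {s : Memory} :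
    (Expr.lt e₁ e₂).eval s ≠ 0 ↔ e₁.eval s < e₂.eval s := by
  rw [Expr.eval]
  split <;> simp [*]

theorem Expr.eval_lt_eq_zero {e₁ e₂ : Expr} {s : Memory} :
    (Expr.lt e₁ e₂).eval s = 0 ↔ e₂.eval s ≤ e₁.eval s := by
  rw [← not_lt, ← Expr.eval_lt_ne_zero, not_not]

theorem Expr.eval_eq_ne_zero {e₁ e₂ : Expr} {s : Memory} :
    (Expr.eq e₁ e₂).eval s ≠ 0 ↔ e₁.eval s = e₂.eval s := by
  rw [Expr.eval]
  split <;> simp [*]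

theorem Expr.eval_eq_eq_zero {e₁ e₂ : Expr} {s : Memory} :
    (Expr.eq e₁ e₂).eval s = 0 ↔ e₁.eval s ≠ e₂.eval s := by
  rw [ne_eq, ← Expr.eval_eq_ne_zero, not_not]

/-- The memory holds the lists of outneighbours of `D`. -/
structure Stores {n : ℕ} (D : Digraph (Fin n)) (s : Memory) : Prop where
  reg_zero : s.reg 0 = n
  offset_zero : s.arr 0 0 = 0
  offset_mono : ∀ u, u < n → s.arr 0 u ≤ s.arr 0 (u + 1)
  offset_last : s.arr 0 n = D.numArcs
  outneighbours : ∀ u : Fin n,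
    Set.BijOn (s.arr 1) (Set.Ico (s.arr 0 u) (s.arr 0 (u + 1))) {x | ∃ v : Fin n, D.Adj u v ∧ x = v}

section Stores

variable {n : ℕ} {D : Digraph (Fin n)} {s s' : Memory}

theorem IsInput.stores (h : IsInput D s) : Stores D s :=
  ⟨h.reg_zero, h.offset_zero, h.offset_mono, h.offset_last, h.outneighbours⟩

theorem Stores.congr (h : Stores D s) (h0 : s'.reg 0 = s.reg 0) (h1 : ∀ i, s'.arr 0 i = s.arr 0 i)
    (h2 : ∀ i, s'.arr 1 i = s.arr 1 i) : Stores D s' := by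
  have h1 : s'.arr 0 = s.arr 0 := funext h1
  have h2 : s'.arr 1 = s.arr 1 := funext h2
  obtain ⟨a, b, c, d, e⟩ := h
  constructor <;> simp only [h0, h1, h2] <;> assumption

theorem Stores.setReg (h : Stores D s) {i x : ℕ} (hi : i ≠ 0) : Stores D (s.setReg i x) :=
  h.congr (by simp [hi.symm]) (by simp) (by simp)

theorem Stores.setArr (h : Stores D s) {a i x : ℕ} (ha : 2 ≤ a) : Stores D (s.setArr a i x) :=
  h.congr (by simp) (fun _ => by simp; omega) (fun _ => by simp; omega)

theorem Stores.sum_range_outdegree (h : Stores D s) {k : ℕ} (hk : k ≤ n) :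
    ∑ i ∈ Finset.range k, (s.arr 0 (i + 1) - s.arr 0 i) = s.arr 0 k := by
  induction k with
  | zero => simp [h.offset_zero]
  | succ k ih =>
    rw [Finset.sum_range_succ, ih (by omega)]
    have := h.offset_mono k (by omega)
    omega

/-- The amortized bound for a search that processes each vertex at most once. -/
theorem Stores.sum_outdegree_le (h : Stores D s) {l : List (Fin n)} (hl : l.Nodup) :
    (l.map fun x => 1 + (s.arr 0 (x.val + 1) - s.arr 0 x.val)).sum ≤ n + D.numArcs := by
  classical
  rw [← List.sum_toFinset _ hl]
  calc _ ≤ ∑ x : Fin n, (1 + (s.arr 0 (x.val + 1) - s.arr 0 x.val)) :=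
        Finset.sum_le_sum_of_subset (Finset.subset_univ _)
    _ = _ := by
      rw [Finset.sum_add_distrib, Fin.sum_univ_eq_sum_range
        (fun i => s.arr 0 (i + 1) - s.arr 0 i) n, h.sum_range_outdegree le_rfl, h.offset_last]
      simp

theorem Stores.outdegree_le (h : Stores D s) (x : Fin n) :
    s.arr 0 (x + 1) - s.arr 0 x ≤ n + D.numArcs := by
  have := h.sum_outdegree_le (l := [x]) (by simp)
  simp at this
  omega

theorem Stores.exists_adj (h : Stores D s) {x : Fin n} {e : ℕ} (h1 : s.arr 0 x ≤ e)
    (h2 : e < s.arr 0 (x + 1)) : ∃ v : Fin n, D.Adj x v ∧ s.arr 1 e = v :=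
  (h.outneighbours x).mapsTo ⟨h1, h2⟩

theorem Stores.exists_index (h : Stores D s) {x v : Fin n} (hv : D.Adj x v) :
    ∃ e, s.arr 0 x ≤ e ∧ e < s.arr 0 (x + 1) ∧ s.arr 1 e = v := by
  obtain ⟨e, he, hev⟩ := (h.outneighbours x).surjOn ⟨v, hv, rfl⟩
  exact ⟨e, he.1, he.2, hev⟩

end Stores

/-- `x` is the truth value of `p`. -/
def Answers (p : Prop) (x : ℕ) : Prop :=
  (p ∧ x = 1) ∨ (¬ p ∧ x = 0)

theorem answers_ite (p : Prop) [Decidable p] : Answers p (if p then 1 else 0) := by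
  by_cases h : p <;> simp [Answers, h]

theorem Answers.congr {p q : Prop} {x : ℕ} (h : Answers p x) (hpq : p ↔ q) : Answers q x := by
  rwa [Answers, ← hpq]

/-- The property `φ` of the vertices in the registers `10, …, 10 + d - 1` can be decided in
`O(n ^ e * (n + m))` steps, without changing these registers; the answer is left in `reg 2`. -/
def Decidable (d e : ℕ) (φ : ∀ n, Digraph (Fin n) → (ℕ → Fin n) → Prop) : Prop :=
  ∃ (P : Program) (K : ℕ), ∀ (n : ℕ) (D : Digraph (Fin n)) (ρ : ℕ → Fin n) (s : Memory),
    Stores D s → (∀ j < d, s.reg (10 + j) = ρ j) →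
    Runs P s (K * (n ^ e * (n + D.numArcs))) fun s' =>
      Stores D s' ∧ (∀ j < d, s'.reg (10 + j) = ρ j) ∧ Answers (φ n D ρ) (s'.reg 2)

/-! ### Closure of decidability under connectives and quantifiers -/

section Connectives

variable {d e : ℕ} {φ ψ : ∀ n, Digraph (Fin n) → (ℕ → Fin n) → Prop}

theorem one_le_pow_mul {n : ℕ} (hn : 0 < n) (e m : ℕ) : 1 ≤ n ^ e * (n + m) :=
  Nat.mul_pos (Nat.pow_pos hn) (by omega)

theorem Decidable.mono (h : Decidable d e φ) {e' : ℕ} (he : e ≤ e') : Decidable d e' φ := by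
  obtain ⟨P, K, h⟩ := h
  refine ⟨P, K, fun n D ρ s hs hρ => (h n D ρ s hs hρ).mono ?_ fun _ h => h⟩
  have := Nat.pow_le_pow_right (ρ 0).pos he
  gcongr

theorem Decidable.not (h : Decidable d e φ) : Decidable d e fun n D ρ => ¬ φ n D ρ := by
  obtain ⟨P, K, h⟩ := h
  refine ⟨.seq P (.assign 2 (.eq (.reg 2) (.const 0))), K + 4, fun n D ρ s hs hρ => ?_⟩
  refine Runs.seq (T₂ := 4) (Runs.mono (h n D ρ s hs hρ) le_rfl ?_) ?_
  · rintro s' ⟨h1, h2, h3⟩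
    refine runs_assign ⟨h1.setReg (by norm_num), fun j hj => ?_, ?_⟩ (by simp)
    · rw [← h2 j hj]
      simp
      omega
    · rcases h3 with ⟨h3, h4⟩ | ⟨h3, h4⟩ <;> simp [Answers, h3, h4]
  · have := one_le_pow_mul (ρ 0).pos e D.numArcs
    rw [add_mul]
    omega

theorem Decidable.and (h : Decidable d e φ) (h' : Decidable d e ψ) :
    Decidable d e fun n D ρ => φ n D ρ ∧ ψ n D ρ := by
  obtain ⟨P, K, h⟩ := h
  obtain ⟨P', K', h'⟩ := h'
  refine ⟨.seq P (.ite (.reg 2) P' .skip), K + (K' + 3), fun n D ρ s hs hρ => ?_⟩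
  have h0 := one_le_pow_mul (ρ 0).pos e D.numArcs
  refine Runs.seq (Runs.mono (h n D ρ s hs hρ) le_rfl ?_) (add_mul _ _ _).ge
  rintro s' ⟨h1, h2, h3⟩
  rw [add_mul]
  have h' := h' n D ρ s' h1 h2
  generalize n ^ e * (n + D.numArcs) = N at *
  refine runs_ite (T₁ := K' * N + 1) (fun he => ?_) (fun he => ?_) (by simp; omega)
  · refine h'.mono (Nat.le_succ _) fun s'' ⟨h4, h5, h6⟩ => ⟨h4, h5, ?_⟩
    rcases h3 with ⟨h3, _⟩ | ⟨_, h3⟩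
    · simpa [h3] using h6
    · exact absurd h3 he
  · refine runs_skip ⟨h1, h2, ?_⟩ (by omega)
    rcases h3 with ⟨_, h3⟩ | ⟨h3, h4⟩
    · simp [h3] at he
    · simp [Answers, h3, h4]

theorem Decidable.exists (h : Decidable (d + 1) e φ) :
    Decidable d (e + 1) fun n D ρ => ∃ k, φ n D (Function.update ρ d k) := by
  obtain ⟨P, K, h⟩ := h
  refine ⟨.seq (.assign (10 + d) (.const 0)) (.seq (.assign 2 (.const 0))
    -- As `reg 2` is `0` or `1`, this one test says that nothing has been found yet and that
    -- candidates remain.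
    (.while (.lt (.reg 2) (.lt (.reg (10 + d)) (.reg 0)))
      (.seq P (.assign (10 + d) (.succ (.reg (10 + d))))))), K + 19, fun n D ρ s hs hρ => ?_⟩
  have hn := (ρ 0).pos
  have h0 := one_le_pow_mul hn e D.numArcs
  rw [pow_succ', mul_assoc]
  generalize hN : n ^ e * (n + D.numArcs) = N at *
  refine runs_assign_seq (T₁ := n * (K * N + 9) + 8) (runs_assign_seq
    (T₁ := n * (K * N + 9) + 6) (runs_while (k := n * (K * N + 9)) (Inv := fun k s => ∃ i ≤ n,
      Stores D s ∧ (∀ j < d, s.reg (10 + j) = ρ j) ∧ s.reg (10 + d) = i ∧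
      Answers (∃ x : Fin n, x < i ∧ φ n D (Function.update ρ d x)) (s.reg 2) ∧
      k = (n - i) * (K * N + 9)) ?_ ?_ ?_ ?_) ?_) ?_
  · rintro k s ⟨i, hi, hs, hρ, hd, ha, rfl⟩ he
    have hin : i < n := by
      by_contra hin
      simp [hd, hs.reg_zero, hin] at he
    have ha : ¬ ∃ x : Fin n, x < i ∧ φ n D (Function.update ρ d x) := by
      rcases ha with ⟨_, ha⟩ | ⟨ha, _⟩
      · rw [Expr.eval_lt_ne_zero] at he
        simp only [Expr.eval, ha, hd, hs.reg_zero, if_pos hin, lt_irrefl] at he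
      · exact ha
    refine ⟨K * N + 3, Runs.seq (T₁ := K * N) (T₂ := 3) ((h n D (Function.update ρ d ⟨i, hin⟩) s
      hs fun j hj => ?_).mono (by rw [hN]) fun s' ⟨h1, h2, h3⟩ => ?_) le_rfl⟩
    · rcases Nat.lt_succ_iff_lt_or_eq.1 hj with hj | rfl
      · rw [Function.update_of_ne hj.ne, hρ j hj]
      · simp [hd]
    · have hd' := h2 d (Nat.lt_succ_self d)
      simp only [Function.update_self] at hd'
      refine runs_assign ⟨_, ⟨i + 1, hin, h1.setReg (by omega), fun j hj => ?_, ?_, ?_, rfl⟩, ?_⟩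
        (by simp)
      · have := h2 j (by omega)
        rw [Function.update_of_ne hj.ne] at this
        rw [← this]
        simp
        omega
      · simp [hd']
      · have : (∃ x : Fin n, x < i + 1 ∧ φ n D (Function.update ρ d x)) ↔
            φ n D (Function.update ρ d ⟨i, hin⟩) := by
          constructor
          · rintro ⟨x, hx, hφ⟩
            rcases Nat.lt_succ_iff_lt_or_eq.1 hx with hx | hx
            · exact absurd ⟨x, hx, hφ⟩ ha
            · rwa [show (⟨i, hin⟩ : Fin n) = x from Fin.ext hx.symm]
          · exact fun h => ⟨⟨i, hin⟩, Nat.lt_succ_self i, h⟩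
        rw [this]
        rw [Memory.reg_setReg, if_neg (by omega)]
        exact h3
      · have : n - i = n - (i + 1) + 1 := by omega
        rw [this, add_mul]
        simp
        omega
  · refine ⟨0, Nat.zero_le _, (hs.setReg (by omega)).setReg (by norm_num), fun j hj => ?_, ?_, ?_,
      by simp⟩
    · rw [← hρ j hj]
      simp [show 10 + j ≠ 2 by omega, hj.ne]
    · simp
    · simp [Answers]
  · simp
  · rintro k s' ⟨i, hi, hs, hρ, hd, ha, -⟩ he
    refine ⟨hs, hρ, ?_⟩
    rcases ha with ⟨⟨x, _, hx⟩, ha⟩ | ⟨hn, ha⟩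
    · exact Or.inl ⟨⟨x, hx⟩, ha⟩
    · refine Or.inr ⟨?_, ha⟩
      rintro ⟨x, hx⟩
      refine hn ⟨x, ?_, hx⟩
      have : ¬ i < n := by
        intro hin
        simp [ha, hd, hs.reg_zero, hin] at he
      have := x.isLt
      omega
  · simp
    omega
  · simp only [Expr.cost]
    have h1 : n ≤ n * N := Nat.le_mul_of_pos_right n h0
    have h2 : n * (K * N + 9) = K * (n * N) + 9 * n := by ring
    have h3 : (K + 19) * (n * N) = K * (n * N) + 19 * (n * N) := by ring
    omega

end Connectives

/-! ### Equality and adjacency tests -/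

section Atoms

variable {d i j : ℕ}

theorem decidable_eq (hi : i < d) (hj : j < d) : Decidable d 0 fun _ _ ρ => ρ i = ρ j := by
  refine ⟨.assign 2 (.eq (.reg (10 + i)) (.reg (10 + j))), 4, fun n D ρ s hs hρ => ?_⟩
  have h0 := (ρ 0).pos
  refine runs_assign ⟨hs.setReg (by norm_num), fun k hk => ?_, ?_⟩ (by simp; omega)
  · rw [← hρ k hk]
    simp
    omega
  · simp only [Expr.eval, hρ i hi, hρ j hj, Memory.reg_setReg, if_true, Fin.val_inj]
    exact answers_ite _

theorem decidable_adj (hi : i < d) (hj : j < d) :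
    Decidable d 0 fun _ D ρ => D.Adj (ρ i) (ρ j) := by
  refine ⟨.seq (.assign 2 (.const 0)) (.seq (.assign 5 (.get 0 (.reg (10 + i))))
    (.seq (.assign 6 (.get 0 (.succ (.reg (10 + i)))))
    (.while (.lt (.reg 5) (.reg 6)) (.seq
      (.ite (.eq (.get 1 (.reg 5)) (.reg (10 + j))) (.assign 2 (.const 1)) .skip)
      (.assign 5 (.succ (.reg 5))))))), 27, fun n D ρ s hs hρ => ?_⟩
  have hn := (ρ 0).pos
  rw [pow_zero, one_mul]
  have hdeg := hs.outdegree_le (ρ i)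
  refine runs_assign_seq (T₁ := 14 * (n + D.numArcs) + 11) (runs_assign_seq
    (T₁ := 14 * (n + D.numArcs) + 8) (runs_assign_seq (T₁ := 14 * (n + D.numArcs) + 4)
    (runs_while (k := 14 * (n + D.numArcs)) (Inv := fun k s => Stores D s ∧
      (∀ j < d, s.reg (10 + j) = ρ j) ∧ s.arr 0 (ρ i) ≤ s.reg 5 ∧
      s.reg 6 = s.arr 0 (ρ i + 1) ∧ s.reg 5 ≤ s.reg 6 ∧
      Answers (∃ e, s.arr 0 (ρ i) ≤ e ∧ e < s.reg 5 ∧ s.arr 1 e = ρ j) (s.reg 2) ∧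
      14 * (s.reg 6 - s.reg 5) ≤ k) ?_ ?_ ?_ ?_) ?_) ?_) ?_
  · rintro k s ⟨hs, hρ, h1, h2, -, h3, h4⟩ he
    have he : s.reg 5 < s.reg 6 := Expr.eval_lt_ne_zero.1 he
    refine ⟨10, Runs.seq (T₁ := 7) (T₂ := 3) (runs_ite (T₁ := 2)
      (Q := fun s' => s'.arr = s.arr ∧ (∀ k ≠ 2, s'.reg k = s.reg k) ∧
        Answers (∃ e, s.arr 0 (ρ i) ≤ e ∧ e < s.reg 5 + 1 ∧ s.arr 1 e = ρ j) (s'.reg 2))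
      (fun hq => runs_assign ⟨rfl, fun k hk => by simp [hk], Or.inl ⟨⟨s.reg 5, h1, by omega,
        by
          rw [Expr.eval_eq_ne_zero] at hq
          exact hq.trans (hρ j hj)⟩, by simp⟩⟩ (by simp))
      (fun hq => runs_skip ⟨rfl, fun _ _ => rfl, ?_⟩ (by norm_num)) (by simp) |>.mono le_rfl ?_)
      le_rfl⟩
    · have : (∃ e, s.arr 0 (ρ i) ≤ e ∧ e < s.reg 5 + 1 ∧ s.arr 1 e = ρ j) ↔
          ∃ e, s.arr 0 (ρ i) ≤ e ∧ e < s.reg 5 ∧ s.arr 1 e = ρ j := by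
        refine exists_congr fun e => and_congr_right fun _ => and_congr_left fun h => ?_
        refine ⟨fun h' => lt_of_le_of_ne (Nat.lt_succ_iff.1 h') ?_, fun h => by omega⟩
        rintro rfl
        exact Expr.eval_eq_eq_zero.1 hq (h.trans (hρ j hj).symm)
      rwa [this]
    · rintro s' ⟨h5, h6, h7⟩
      refine runs_assign ⟨k - 14, ⟨?_, ?_, ?_, ?_, ?_, ?_, ?_⟩, ?_⟩ (by simp)
      · exact hs.congr (by simp [h6]) (by simp [h5]) (by simp [h5])
      · intro k hk
        rw [← hρ k hk, ← h6 (10 + k) (by omega)]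
        simp
        omega
      · simp [h5, h6]
        omega
      · simp [h5, h6, h2]
      · simp [h6]
        omega
      · simpa [h5, h6] using h7
      · simp [h6]
        omega
      · simp
        omega
  · have hi' := hρ i hi
    have hmono := hs.offset_mono _ (ρ i).isLt
    have h2 : 10 + i ≠ 2 := by omega
    have h5 : 10 + i ≠ 5 := by omega
    refine ⟨((hs.setReg (by norm_num)).setReg (by norm_num)).setReg (by norm_num), fun k hk => ?_,
      ?_, ?_, ?_, Or.inr ⟨?_, ?_⟩, ?_⟩
    · rw [← hρ k hk]
      simp [show 10 + k ≠ 2 by omega, show 10 + k ≠ 5 by omega, show 10 + k ≠ 6 by omega]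
    · simp [h2, hi']
    · simp [h2, h5, hi']
    · simpa [h2, h5, hi'] using hmono
    · simp only [Memory.reg_setReg, Memory.arr_setReg, Expr.eval, h2, hi', if_false, if_true]
      rintro ⟨e, h1, h2, -⟩
      simp at h2
      omega
    · simp
    · simp [h2, h5, hi']
      omega
  · simp
  · rintro k s' ⟨hs, hρ, h1, h2, h5, h3, h4⟩ he
    have he : s'.reg 6 ≤ s'.reg 5 := Expr.eval_lt_eq_zero.1 he
    refine ⟨hs, hρ, ?_⟩
    convert h3 using 1
    refine ⟨fun h => ?_, ?_⟩
    · obtain ⟨e, he1, he2, he3⟩ := hs.exists_index h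
      exact ⟨e, he1, by omega, he3⟩
    · rintro ⟨e, he1, he2, he3⟩
      obtain ⟨v, hv, hv'⟩ := hs.exists_adj he1 (h2 ▸ he2.trans_le h5)
      rwa [Fin.ext (he3.symm.trans hv')]
  all_goals simp; omega

end Atoms

end RAM

/-! ### Reachability by breadth-first search -/

namespace RAM

section Search

variable {n : ℕ} {D : Digraph (Fin n)} {m₀ s : Memory} {a b x₀ : Fin n} {q : List (Fin n)}

/-- A search from `x₀` that avoids `a` and `b` has so far found the vertices in `q`. The array `3`
is the queue, of length `reg 4`; the array `2` marks the elements of `q` by `1` and the other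
vertices to be avoided by `2`. Everything else is as in the memory `m₀`. -/
structure Search (D : Digraph (Fin n)) (m₀ : Memory) (a b x₀ : Fin n) (q : List (Fin n))
    (s : Memory) : Prop where
  reg_zero : s.reg 0 = m₀.reg 0
  reg_add : ∀ j, s.reg (10 + j) = m₀.reg (10 + j)
  arr_zero : s.arr 0 = m₀.arr 0
  arr_one : s.arr 1 = m₀.arr 1
  nodup : q.Nodup
  source_mem : x₀ ∈ q
  tail : s.reg 4 = q.length
  queue : ∀ i (h : i < q.length), s.arr 3 i = q[i]
  mark : ∀ y : Fin n, s.arr 2 y = if y ∈ q then 1 else if y = a ∨ y = b then 2 else 0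
  reach : ∀ y ∈ q, D.ReachAvoiding a b x₀ y

theorem Search.setReg (h : Search D m₀ a b x₀ q s) {i x : ℕ} (h0 : i ≠ 0) (h4 : i ≠ 4)
    (h10 : i < 10) : Search D m₀ a b x₀ q (s.setReg i x) where
  reg_zero := by simp [h0.symm, h.reg_zero]
  reg_add j := by
    rw [← h.reg_add j]
    simp
    omega
  arr_zero := h.arr_zero
  arr_one := h.arr_one
  nodup := h.nodup
  source_mem := h.source_mem
  tail := by simp [h4.symm, h.tail]
  queue := h.queue
  mark := h.mark
  reach := h.reach

theorem Search.push (h : Search D m₀ a b x₀ q s) {y : Fin n} (hy : y ∉ q)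
    (hr : D.ReachAvoiding a b x₀ y) :
    Search D m₀ a b x₀ (q ++ [y])
      (((s.setArr 2 y 1).setArr 3 (s.reg 4) y).setReg 4 (s.reg 4 + 1)) where
  reg_zero := by simp [h.reg_zero]
  reg_add j := by
    rw [← h.reg_add j]
    simp
    omega
  arr_zero := by
    rw [← h.arr_zero]
    funext i
    simp
  arr_one := by
    rw [← h.arr_one]
    funext i
    simp
  nodup := by
    rw [List.nodup_append]
    refine ⟨h.nodup, by simp, fun x hx z hz => ?_⟩
    rw [List.mem_singleton.1 hz]
    rintro rfl
    exact hy hx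
  source_mem := List.mem_append_left _ h.source_mem
  tail := by simp [h.tail]
  queue i hi := by
    rw [List.length_append, List.length_singleton] at hi
    rcases Nat.lt_succ_iff_lt_or_eq.1 hi with hi | rfl
    · simp [h.tail, hi.ne, List.getElem_append_left hi, h.queue i hi]
    · simp [h.tail]
  mark z := by
    by_cases hz : z = y
    · simp [hz]
    · have hz' : z.val ≠ y.val := fun h => hz (Fin.ext h)
      simp [hz, hz', h.mark z]
  reach z hz := by
    rcases List.mem_append.1 hz with hz | hz
    · exact h.reach z hz
    · rwa [List.mem_singleton.1 hz]

/-- Put the outneighbours listed in the entries `reg 5, …, reg 6 - 1` into the queue. -/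
def scanOutneighbours : Program :=
  .while (.lt (.reg 5) (.reg 6)) (.seq
    (.ite (.eq (.get 2 (.get 1 (.reg 5))) (.const 0))
      (.seq (.store 2 (.get 1 (.reg 5)) (.const 1))
        (.seq (.store 3 (.reg 4) (.get 1 (.reg 5))) (.assign 4 (.succ (.reg 4))))) .skip)
    (.assign 5 (.succ (.reg 5))))

theorem runs_scanOutneighbours (hD : Stores D m₀) (h : Search D m₀ a b x₀ q s) {x : Fin n}
    (hx : x ∈ q) (h5 : s.reg 5 = m₀.arr 0 x) (h6 : s.reg 6 = m₀.arr 0 (x + 1)) :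
    Runs scanOutneighbours s (24 * (m₀.arr 0 (x + 1) - m₀.arr 0 x) + 4) fun s' =>
      ∃ r, Search D m₀ a b x₀ (q ++ r) s' ∧ s'.reg 3 = s.reg 3 ∧
        ∀ y, D.Adj x y → y ∈ q ++ r ∨ y = a ∨ y = b := by
  -- Each arc costs four steps for the test and at most twenty for the body.
  refine runs_while (k := 24 * (m₀.arr 0 (x + 1) - m₀.arr 0 x)) (Inv := fun k s' =>
    ∃ r, Search D m₀ a b x₀ (q ++ r) s' ∧ s'.reg 3 = s.reg 3 ∧ s'.reg 6 = m₀.arr 0 (x + 1) ∧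
      m₀.arr 0 x ≤ s'.reg 5 ∧ s'.reg 5 ≤ s'.reg 6 ∧
      (∀ e, m₀.arr 0 x ≤ e → e < s'.reg 5 → ∀ y : Fin n, m₀.arr 1 e = y →
        y ∈ q ++ r ∨ y = a ∨ y = b) ∧ 24 * (s'.reg 6 - s'.reg 5) ≤ k) ?_ ?_ (by simp) ?_
  · rintro k s₁ ⟨r, hs, h3, h6, h5, h56, hcl, hk⟩ he
    have he : s₁.reg 5 < s₁.reg 6 := Expr.eval_lt_ne_zero.1 he
    obtain ⟨y, hxy, hy⟩ := hD.exists_adj h5 (h6 ▸ he)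
    have hget : (Expr.get 1 (.reg 5)).eval s₁ = y := by simp [hs.arr_one, hy]
    have hget₂ : (Expr.get 2 (.get 1 (.reg 5))).eval s₁ = s₁.arr 2 y := by rw [Expr.eval, hget]
    refine ⟨20, Runs.seq (T₁ := 17) (T₂ := 3) (runs_ite (T₁ := 11)
      (Q := fun s' => ∃ r', Search D m₀ a b x₀ (q ++ (r ++ r')) s' ∧
        (y ∈ q ++ (r ++ r') ∨ y = a ∨ y = b) ∧ ∀ i ≠ 4, s'.reg i = s₁.reg i)
      (fun hq => ?_) (fun hq => ?_) (by simp) |>.mono le_rfl ?_) le_rfl⟩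
    · rw [Expr.eval_eq_ne_zero, hget₂, hs.mark, Expr.eval] at hq
      have hyq : y ∉ q ++ r := fun h => by simp [h] at hq
      rw [if_neg hyq] at hq
      have hyab : ¬ (y = a ∨ y = b) := fun h => by simp [h] at hq
      rw [not_or] at hyab
      have hpush := hs.push hyq ((hs.reach x (List.mem_append_left _ hx)).tail ⟨hxy, hyab⟩)
      refine runs_store_seq (T₁ := 7) (runs_store_seq (T₁ := 3) (runs_assign ⟨[y], ?_, ?_, ?_⟩
        (by simp)) (by simp)) (by simp)
      · rw [← List.append_assoc]
        convert hpush using 3 <;> simp [hs.arr_one, hy]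
      · simp
      · intro i hi
        simp [hi]
    · rw [Expr.eval_eq_eq_zero, hget₂, hs.mark, Expr.eval] at hq
      refine runs_skip ⟨[], by simpa using hs, ?_, fun _ _ => rfl⟩ (by norm_num)
      by_contra! h
      rw [List.append_nil] at h
      simp [h] at hq
    · rintro s₂ ⟨r', hs₂, hyr, hreg⟩
      refine runs_assign ⟨k - 24, ⟨r ++ r', hs₂.setReg (by norm_num) (by norm_num) (by norm_num),
        ?_, ?_, ?_, ?_, ?_, ?_⟩, ?_⟩ (by simp)
      · simp [hreg, h3]
      · simp [hreg, h6]
      · simp [hreg]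
        omega
      · simp [hreg]
        omega
      · intro e he1 he2 z hz
        simp only [Memory.reg_setReg, if_true, Expr.eval, hreg 5 (by norm_num)] at he2
        rcases Nat.lt_succ_iff_lt_or_eq.1 he2 with he2 | rfl
        · rcases hcl e he1 he2 z hz with h | h
          · left
            rw [← List.append_assoc]
            exact List.mem_append_left _ h
          · exact Or.inr h
        · rwa [Fin.ext (hz.symm.trans hy)]
      · simp [hreg]
        omega
      · simp
        omega
  · have := hD.offset_mono _ x.isLt
    exact ⟨[], by simpa using h, rfl, h6, h5.ge, by omega, fun e h1 h2 => by omega, by omega⟩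
  · rintro k s' ⟨r, hs, h3, h6, h5, h56, hcl, -⟩ he
    have he : s'.reg 6 ≤ s'.reg 5 := Expr.eval_lt_eq_zero.1 he
    refine ⟨r, hs, h3, fun y hy => ?_⟩
    obtain ⟨e, he1, he2, he3⟩ := hD.exists_index hy
    exact hcl e he1 (by omega) y he3

/-- Process the queue until it is empty. -/
def processQueue : Program :=
  .while (.lt (.reg 3) (.reg 4))
    (.seq (.assign 5 (.get 0 (.get 3 (.reg 3))))
    (.seq (.assign 6 (.get 0 (.succ (.get 3 (.reg 3)))))
    (.seq (.assign 3 (.succ (.reg 3))) scanOutneighbours)))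

/-- The queue splits into a processed part `p` and a waiting part `r`. Processing `x` costs at most
`24` times one plus its outdegree, and the queue has no repetitions, so the total is linear. -/
theorem runs_processQueue (hD : Stores D m₀) (h : Search D m₀ a b x₀ [x₀] s)
    (h3 : s.reg 3 = 0) :
    Runs processQueue s (24 * (n + D.numArcs) + 4) fun s' =>
      ∃ q, Search D m₀ a b x₀ q s' ∧ ∀ x ∈ q, ∀ y, D.Adj x y → y ∈ q ∨ y = a ∨ y = b := by
  let w : List (Fin n) → ℕ := fun l =>
    (l.map fun x => 1 + (m₀.arr 0 (x.val + 1) - m₀.arr 0 x.val)).sum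
  refine runs_while (k := 24 * (n + D.numArcs)) (Inv := fun k s' =>
    ∃ p r, Search D m₀ a b x₀ (p ++ r) s' ∧ s'.reg 3 = p.length ∧
      (∀ x ∈ p, ∀ y, D.Adj x y → y ∈ p ++ r ∨ y = a ∨ y = b) ∧
      24 * (n + D.numArcs) ≤ k + 24 * w p) ?_ ?_ (by simp) ?_
  · rintro k s₁ ⟨p, r, hs, h3, hcl, hk⟩ he
    have he : s₁.reg 3 < s₁.reg 4 := Expr.eval_lt_ne_zero.1 he
    rw [h3, hs.tail, List.length_append] at he
    obtain ⟨x, r, rfl⟩ := List.exists_cons_of_length_pos (show 0 < r.length by omega)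
    have hqx : s₁.arr 3 p.length = x := by
      rw [hs.queue _ (by simp)]
      simp
    have hw : w (p ++ [x]) = w p + (1 + (m₀.arr 0 (x + 1) - m₀.arr 0 x)) := by
      simp [w]
      omega
    rw [List.append_cons] at hs hcl
    have hle : w (p ++ [x]) ≤ n + D.numArcs :=
      hD.sum_outdegree_le (hs.nodup.sublist (List.sublist_append_left _ _))
    refine ⟨24 * (m₀.arr 0 (x + 1) - m₀.arr 0 x) + 17, runs_assign_seq
      (T₁ := 24 * (m₀.arr 0 (x + 1) - m₀.arr 0 x) + 12) (runs_assign_seq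
      (T₁ := 24 * (m₀.arr 0 (x + 1) - m₀.arr 0 x) + 7) (runs_assign_seq
      (T₁ := 24 * (m₀.arr 0 (x + 1) - m₀.arr 0 x) + 4) ((runs_scanOutneighbours hD
      (((hs.setReg ?_ ?_ ?_).setReg ?_ ?_ ?_).setReg ?_ ?_ ?_) (x := x) ?_ ?_ ?_).mono
      le_rfl ?_) ?_) ?_) ?_⟩
    any_goals simp only [Expr.cost]; omega
    any_goals norm_num
    · simp [h3, hqx, hs.arr_zero]
    · simp [h3, hqx, hs.arr_zero]
    · rintro s' t hs' h3' hadj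
      refine ⟨k - 24 * (1 + (m₀.arr 0 (x + 1) - m₀.arr 0 x)), ⟨p ++ [x], r ++ t, ?_, ?_, ?_, ?_⟩,
        ?_⟩
      · simpa using hs'
      · simp [h3', h3]
      · intro z hz y hzy
        rcases List.mem_append.1 hz with hz | hz
        · have := hcl z hz y hzy
          simp only [List.mem_append] at this ⊢
          tauto
        · rw [List.mem_singleton.1 hz] at hzy
          have := hadj y hzy
          simp only [List.mem_append, List.mem_cons] at this ⊢
          tauto
      · omega
      · omega
  · exact ⟨[], [x₀], h, by simpa using h3, by simp, by simp⟩
  · rintro k s' ⟨p, r, hs, h3, hcl, -⟩ he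
    have he : s'.reg 4 ≤ s'.reg 3 := Expr.eval_lt_eq_zero.1 he
    rw [h3, hs.tail, List.length_append] at he
    obtain rfl : r = [] := List.length_eq_zero_iff.1 (by omega)
    rw [List.append_nil] at hs hcl
    exact ⟨p, hs, hcl⟩

/-- Erase the marks of all vertices. -/
def clearMarks : Program :=
  .seq (.assign 3 (.const 0)) (.while (.lt (.reg 3) (.reg 0))
    (.seq (.store 2 (.reg 3) (.const 0)) (.assign 3 (.succ (.reg 3)))))

theorem runs_clearMarks (s : Memory) :
    Runs clearMarks s (10 * s.reg 0 + 6) fun s' =>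
      (∀ i ≠ 3, s'.reg i = s.reg i) ∧ (∀ k ≠ 2, s'.arr k = s.arr k) ∧
        ∀ i < s.reg 0, s'.arr 2 i = 0 := by
  refine runs_assign_seq (T₁ := 10 * s.reg 0 + 4) (runs_while (k := 10 * s.reg 0)
    (Inv := fun k s' => (∀ i ≠ 3, s'.reg i = s.reg i) ∧ (∀ k ≠ 2, s'.arr k = s.arr k) ∧
      (∀ i < s'.reg 3, s'.arr 2 i = 0) ∧ 10 * (s.reg 0 - s'.reg 3) ≤ k) ?_ ?_ (by simp) ?_)
    (by simp; omega)
  · rintro k s' ⟨h1, h2, h3, h4⟩ he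
    have he : s'.reg 3 < s'.reg 0 := Expr.eval_lt_ne_zero.1 he
    rw [h1 0 (by norm_num)] at he
    refine ⟨6, runs_store_seq (T₁ := 3) (runs_assign ⟨k - 10, ⟨?_, ?_, ?_, ?_⟩, ?_⟩ (by simp))
      (by simp)⟩
    · intro i hi
      simp [hi, h1 i hi]
    · intro j hj
      rw [← h2 j hj]
      funext i
      simp [hj]
    · intro i hi
      simp at hi ⊢
      intro hne
      exact h3 i (by omega)
    · simp
      omega
    · simp
      omega
  · refine ⟨fun i hi => by simp [hi], fun _ _ => rfl, by simp, by simp⟩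
  · rintro k s' ⟨h1, h2, h3, -⟩ he
    have he : s'.reg 0 ≤ s'.reg 3 := Expr.eval_lt_eq_zero.1 he
    rw [h1 0 (by norm_num)] at he
    exact ⟨h1, h2, fun i hi => h3 i (by omega)⟩

end Search

theorem decidable_reachAvoiding {d i j k l : ℕ} (hi : i < d) (hj : j < d) (hk : k < d)
    (hl : l < d) :
    Decidable d 0 fun _ D ρ => D.ReachAvoiding (ρ i) (ρ j) (ρ k) (ρ l) := by
  -- The source is marked last, so it counts as found even if it is one of the avoided vertices;
  -- `ReachAvoiding` does not test the start of a walk either.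
  refine ⟨.seq clearMarks (.seq (.store 2 (.reg (10 + i)) (.const 2))
    (.seq (.store 2 (.reg (10 + j)) (.const 2)) (.seq (.store 2 (.reg (10 + k)) (.const 1))
    (.seq (.store 3 (.const 0) (.reg (10 + k))) (.seq (.assign 3 (.const 0))
    (.seq (.assign 4 (.const 1)) (.seq processQueue
    (.assign 2 (.eq (.get 2 (.reg (10 + l))) (.const 1)))))))))), 70, fun n D ρ s hs hρ => ?_⟩
  have hn := (ρ 0).pos
  rw [pow_zero, one_mul]
  refine Runs.seq (T₂ := 24 * (n + D.numArcs) + 25) ((runs_clearMarks s).mono le_rfl ?_) ?_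
  · rintro s₁ ⟨h1, h2, h3⟩
    rw [hs.reg_zero] at h3
    have hρ₁ : ∀ j < d, s₁.reg (10 + j) = ρ j := fun j hj => by
      rw [h1 _ (by omega), hρ j hj]
    refine runs_store_seq (T₁ := 24 * (n + D.numArcs) + 22) (runs_store_seq
      (T₁ := 24 * (n + D.numArcs) + 19) (runs_store_seq
      (T₁ := 24 * (n + D.numArcs) + 16) (runs_store_seq
      (T₁ := 24 * (n + D.numArcs) + 13) (runs_assign_seq
      (T₁ := 24 * (n + D.numArcs) + 11) (runs_assign_seq
      (T₁ := 24 * (n + D.numArcs) + 9) (Runs.seq (T₁ := 24 * (n + D.numArcs) + 4) (T₂ := 5)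
      ((runs_processQueue (a := ρ i) (b := ρ j) (x₀ := ρ k) hs ?_ ?_).mono le_rfl ?_) ?_)
      ?_) ?_) ?_) ?_) ?_) ?_
    · refine ⟨?_, ?_, ?_, ?_, ?_, ?_, ?_, ?_, ?_, ?_⟩
      · simp [h1]
      · intro j
        rw [← h1 (10 + j) (by omega)]
        simp [show 10 + j ≠ 4 by omega, show 10 + j ≠ 3 by omega]
      · rw [← h2 0 (by norm_num)]
        funext i
        simp
      · rw [← h2 1 (by norm_num)]
        funext i
        simp
      · simp
      · simp
      · simp
      · intro i' hi'
        obtain rfl : i' = 0 := by simpa using hi'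
        simp [hρ₁ k hk]
      · intro y
        simp only [Memory.arr_setReg, Memory.arr_setArr, Memory.reg_setArr, Expr.eval, hρ₁ i hi,
          hρ₁ j hj, hρ₁ k hk, h3 y y.isLt, List.mem_singleton, Fin.ext_iff]
        by_cases hk' : y.val = (ρ k).val
        · simp [hk']
        · by_cases hj' : y.val = (ρ j).val
          · simp [hj']
          · by_cases hi' : y.val = (ρ i).val <;> simp [hk', hj', hi']
      · intro y hy
        rw [List.mem_singleton.1 hy]
        exact Relation.ReflTransGen.refl
    · simp
    · rintro s' ⟨q, hq, hcl⟩
      refine runs_assign ⟨?_, ?_, ?_⟩ (by simp)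
      · exact hs.congr (by simp [hq.reg_zero]) (by simp [hq.arr_zero]) (by simp [hq.arr_one])
      · intro j hj
        rw [← hρ j hj, ← hq.reg_add]
        simp
        omega
      -- The final queue contains the source and is closed under permitted arcs, so it contains
      -- every reachable vertex.
      · have hmem : D.ReachAvoiding (ρ i) (ρ j) (ρ k) (ρ l) ↔ ρ l ∈ q := by
          refine ⟨fun h => ?_, hq.reach _⟩
          generalize ρ l = y at h
          induction h with
          | refl => exact hq.source_mem
          | tail _ h ih =>
            rcases hcl _ ih _ h.1 with h' | h'
            · exact h'
            · exact absurd h' (not_or.2 h.2)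
        change Answers (D.ReachAvoiding (ρ i) (ρ j) (ρ k) (ρ l)) _
        rw [hmem]
        simp only [Memory.reg_setReg, if_true, Expr.eval, hq.reg_add, hρ l hl, hq.mark]
        convert answers_ite (ρ l ∈ q) using 1
        by_cases h : ρ l ∈ q
        · simp [h]
        · simp only [h, if_false]
          split <;> simp
    all_goals try simp only [Expr.cost]
    all_goals omega
  · rw [hs.reg_zero]
    omega

end RAM

/-! ### The algorithm -/

theorem mainTheorem2 :
    ∃ (P : RAM.Program) (K : ℕ),
      RAM.DecidesInTime P (fun D => D.ContainsSubdivision wheel3)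
        (fun n m => K * (n ^ 6 * (n + m))) := by
  -- Variables `0`, `1`, `2`, `3` stand for `c`, `v`, `u`, `w`; here `4` and `5` are the pair `a`,
  -- `b`, and in `hexit` variable `4` is `x`. The pair costs two loops, the four outer quantifiers
  -- cost four more.
  have hlink := ((RAM.decidable_eq (d := 6) (i := 4) (j := 0) (by decide) (by decide)).not.and
    ((RAM.decidable_eq (i := 5) (j := 0) (by decide) (by decide)).not.and
    ((RAM.decidable_reachAvoiding (i := 4) (j := 5) (k := 0) (l := 2) (by decide) (by decide)
      (by decide) (by decide)).not.and
    ((RAM.decidable_reachAvoiding (i := 4) (j := 5) (k := 0) (l := 1) (by decide) (by decide)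
      (by decide) (by decide)).not.and
    (RAM.decidable_reachAvoiding (i := 4) (j := 5) (k := 0) (l := 3) (by decide) (by decide)
      (by decide) (by decide)).not)))).exists.exists.not
  have hexit := ((RAM.decidable_adj (d := 5) (i := 4) (j := 3) (by decide) (by decide)).and
    ((RAM.decidable_reachAvoiding (i := 0) (j := 0) (k := 1) (l := 4) (by decide) (by decide)
      (by decide) (by decide)).and
    (RAM.decidable_reachAvoiding (i := 1) (j := 1) (k := 0) (l := 4) (by decide) (by decide)
      (by decide) (by decide)).not)).exists.mono (show 1 ≤ 2 by decide)
  have hrest := ((RAM.decidable_eq (d := 4) (i := 0) (j := 1) (by decide) (by decide)).not.and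
    ((RAM.decidable_eq (i := 0) (j := 2) (by decide) (by decide)).not.and
    ((RAM.decidable_eq (i := 0) (j := 3) (by decide) (by decide)).not.and
    ((RAM.decidable_adj (i := 2) (j := 1) (by decide) (by decide)).and
    (RAM.decidable_reachAvoiding (i := 0) (j := 1) (k := 3) (l := 2) (by decide) (by decide)
      (by decide) (by decide)))))).mono (show 0 ≤ 2 by decide)
  obtain ⟨P, K, hP⟩ : RAM.Decidable 0 6 _ := (hrest.and (hlink.and hexit)).exists.exists.exists.exists
  refine ⟨.seq P (.assign 0 (.reg 2)), K + 2, fun n D s hn _ hs => ?_⟩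
  refine RAM.Runs.seq (T₂ := 2) ((hP n D (fun _ => ⟨0, hn⟩) s hs.stores (by simp)).mono le_rfl ?_) ?_
  · rintro s' ⟨-, -, h⟩
    refine RAM.runs_assign ?_ (by simp)
    simp only [RAM.Memory.reg_setReg, if_true, RAM.Expr.eval]
    refine h.congr ?_
    rw [Digraph.containsSubdivision_wheel3_iff]
    refine exists_congr fun c => exists_congr fun v => exists_congr fun u => exists_congr fun w => ?_
    simp [Digraph.IsWheelWitness]
    clear hP hrest hexit hlink h
    have hforall : (∀ a b, ¬ a = c → ¬ b = c → D.ReachAvoiding a b c u ∨ D.ReachAvoiding a b c v ∨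
        D.ReachAvoiding a b c w) ↔ ∀ a b, ¬ a = c → ¬ b = c → ¬ D.ReachAvoiding a b c u →
          ¬ D.ReachAvoiding a b c v → D.ReachAvoiding a b c w :=
      forall₄_congr fun a b _ _ => by tauto
    rw [hforall]
    tauto
  · have := RAM.one_le_pow_mul hn 6 D.numArcs
    dsimp only
    rw [add_mul]
    omega
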